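/- \textbf{Definitions.} Write $[n]=\{1,\dots,n\}$ and let $\log$ be the natural logarithm. Let $n,e,\ell,L\ge 1$ be integers, let $s_1\le s_2$ and $0\le\gamma\le 1$ be real. A family of forbidden sets $\mathcal{F}=\mathcal{F}_{s_1,s_2}$ (with parameters $e,L$) assigns to every $T\subseteq[n]$ with $|T|\le e$ a collection $\mathcal{F}(T)$ of at most $L$ subsets of $[n]$, each of size in the range $[s_1,s_2]$. A $t\times n$ binary matrix $M$ is $(e,\ell,\gamma,\mathcal{F})$-list disjunct if there are integers $0\le b_1<b_2$ such that for every $T\subseteq[n]$ with $|T|\le e$: (a) every $U\subseteq[n]$ with $|U|\ge\ell$ and $U\cap T=\emptyset$ contains an $i$ such that the number of rows of $M$ that have a one in column $i$ and a zero in every column of $T$ is at least $b_2$; (b) for all but at most $\gamma e$ of the elements $i\in T$, the number of rows of $M$ which (as subsets of $[n]$) contain $i$ and are contained in some $V\in\mathcal{F}(T)$ is at most $b_1$. Space is measured on a random access machine with finitely many registers holding natural numbers, with the instructions constant, addition, truncated subtraction, multiplication, integer division, conditional and while loop, and with an instruction that reads the bit of a read-only string at a position held in a register; the space used is the maximum over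 the computation of the total number of binary digits of the register contents. \textbf{Theorem.} There are absolute constants $\kappa>0$ and $c_0>1$ such that for every real $c\ge c_0$ there are constants $C,\delta,A>0$ and $B$, and a single program $P$, such that the following holds. Let $n\ge 2$ and $e,d,a,L\ge 1$ be integers with $a\le n-d/2$, \[ e\le\kappa\,\frac{d}{\log(L+1)}\qquad\text{and}\qquad c\,e\log n\le n, \] and put $t=\lceil c\,e\log n\rceil$ and $R=\lceil C\,t\,(e+\log L)\,\log(e+1)\,\log n\rceil$. 1. For every family of forbidden sets $\mathcal{F}_{a,n-d/2}$ (with parameters $e,L$) there exists a $t\times n$ matrix that is $(e,e,\frac1{60},\mathcal{F}_{a,n-d/2})$-list disjunct and each of whose rows has at least $\frac{n}{2e}$ ones. 2. There is a map $G$ from $\{0,1\}^R$ to the $t\times n$ binary matrices, not depending on $\mathcal{F}$, such that for every such $\mathcal{F}_{a,n-d/2}$, with probability at least $1-n^{-\delta}$ over a uniformly random $x\in\{0,1\}^R$, the matrix $G(x)$ is $(e,e,\frac1{60},\mathcal{F}_{a,n-d/2})$-list disjunct and each of its rows has at least $\frac{n}{2e}$ ones. 3. For every $x\in\{0,1\}^R$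 and every $(i,j)$, the program $P$ with read-only string $x$ and with $n,e,t,R,i,j$ as input computes the entry $G(x)_{i,j}$ in space at most $A(\log n)^B$. -/

import Mathlib

/-- `F` assigns to every `T ⊆ [n]` with `|T| ≤ e` a collection of at most `L` forbidden subsets
of `[n]`, each of size in the range `[s₁, s₂]`. -/
def IsForbiddenFamily {n : ℕ} (F : Finset (Fin n) → Finset (Finset (Fin n)))
    (e L : ℕ) (s₁ s₂ : ℝ) : Prop :=
  ∀ T : Finset (Fin n), T.card ≤ e →
    (F T).card ≤ L ∧ ∀ S ∈ F T, s₁ ≤ (S.card : ℝ) ∧ (S.card : ℝ) ≤ s₂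

/-- The `j`-th row of a binary matrix, thought of as a subset of `[n]`. -/
def rowSet {t n : ℕ} (M : Matrix (Fin t) (Fin n) Bool) (j : Fin t) : Finset (Fin n) :=
  Finset.univ.filter fun i => M j i = true

open Classical in
/-- The rows in which column `i` has a one and all the columns of `T` have a zero. -/
noncomputable def isolatingRows {t n : ℕ} (M : Matrix (Fin t) (Fin n) Bool) (T : Finset (Fin n)) (i : Fin n) :
    Finset (Fin t) :=
  Finset.univ.filter fun j => M j i = true ∧ ∀ k ∈ T, M j k = false

/-- The rows that contain `i` and are contained in some member of `𝒱`. -/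
def badRows {t n : ℕ} (M : Matrix (Fin t) (Fin n) Bool) (𝒱 : Finset (Finset (Fin n)))
    (i : Fin n) : Finset (Fin t) :=
  Finset.univ.filter fun j => i ∈ rowSet M j ∧ ∃ V ∈ 𝒱, rowSet M j ⊆ V

/-- `(e, ℓ, γ, F)`-list disjunct matrices. In the second property all but at most `γ e` of the
elements of `T` are required to be contained in at most `b₁` bad rows; for `|T| = e` these are
"at least `(1 - γ) e` many `i ∈ T`". -/
def IsListDisjunct {t n : ℕ} (e ℓ : ℕ) (γ : ℝ) (F : Finset (Fin n) → Finset (Finset (Fin n)))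
    (M : Matrix (Fin t) (Fin n) Bool) : Prop :=
  ∃ b₁ b₂ : ℕ, b₁ < b₂ ∧ ∀ T : Finset (Fin n), T.card ≤ e →
    (∀ U : Finset (Fin n), ℓ ≤ U.card → Disjoint U T →
      ∃ i ∈ U, b₂ ≤ (isolatingRows M T i).card) ∧
    ((T.filter fun i => b₁ < (badRows M (F T) i).card).card : ℝ) ≤ γ * e

/-- Every row of the matrix has at least `w` ones. -/
def RowWeightsAtLeast {t n : ℕ} (M : Matrix (Fin t) (Fin n) Bool) (w : ℝ) : Prop :=
  ∀ j : Fin t, w ≤ ((rowSet M j).card : ℝ)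

/-- The number of rows, `t = c e log n` (rounded up). -/
noncomputable def numRows (c : ℝ) (n e : ℕ) : ℕ := ⌈c * e * Real.log n⌉₊

/-- The number of random bits, `C t (e + log L) log (e + 1) log n` (rounded up). -/
noncomputable def numRandomBits (C : ℝ) (n e L t : ℕ) : ℕ :=
  ⌈C * t * (e + Real.log L) * Real.log ((e : ℝ) + 1) * Real.log n⌉₊

/-- Probability of an event under `R` independent unbiased bits. -/
noncomputable def bitProb {R : ℕ} (p : (Fin R → Bool) → Prop) : ℝ :=
  (Set.ncard {x : Fin R → Bool | p x} : ℝ) / 2 ^ R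

/-! ### Random access machines with a read-only string, and their space -/

/-- Programs of a random access machine whose registers are named by `ρ` and hold natural
numbers. `bit r a` puts into `r` the bit of the read-only string at the position held by `a`;
`loop r P` repeats `P` as long as register `r` is nonzero. -/
inductive Prog (ρ : Type) : Type
  | skip : Prog ρ
  | const (r : ρ) (v : ℕ) : Prog ρ
  | add (r a b : ρ) : Prog ρ
  | sub (r a b : ρ) : Prog ρ
  | mul (r a b : ρ) : Prog ρ
  | div (r a b : ρ) : Prog ρ
  | bit (r a : ρ) : Prog ρ
  | seq (P Q : Prog ρ) : Prog ρ
  | ite (r : ρ) (P Q : Prog ρ) : Prog ρ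
  | loop (r : ρ) (P : Prog ρ) : Prog ρ

/-- The bit of `x` at position `p`, and `0` beyond the end of `x`. -/
def readBit {R : ℕ} (x : Fin R → Bool) (p : ℕ) : ℕ :=
  if h : p < R then (x ⟨p, h⟩).toNat else 0

/-- The space taken by the registers: the total number of binary digits of their contents. -/
def storeSize {ρ : Type} [Fintype ρ] (σ : ρ → ℕ) : ℕ := ∑ r, Nat.size (σ r)

/-- `Exec x s P σ τ`: with read-only string `x`, the program `P` started in `σ` halts in `τ`, and
the registers take space at most `s` at every moment of the computation. -/
inductive Exec {ρ : Type} [DecidableEq ρ] [Fintype ρ] {R : ℕ} (x : Fin R → Bool) (s : ℕ) :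
    Prog ρ → (ρ → ℕ) → (ρ → ℕ) → Prop
  | skip {σ : ρ → ℕ} (h : storeSize σ ≤ s) : Exec x s Prog.skip σ σ
  | const {σ : ρ → ℕ} {r : ρ} {v : ℕ} (h : storeSize σ ≤ s)
      (h' : storeSize (Function.update σ r v) ≤ s) :
      Exec x s (Prog.const r v) σ (Function.update σ r v)
  | add {σ : ρ → ℕ} {r a b : ρ} (h : storeSize σ ≤ s)
      (h' : storeSize (Function.update σ r (σ a + σ b)) ≤ s) :
      Exec x s (Prog.add r a b) σ (Function.update σ r (σ a + σ b))
  | sub {σ : ρ → ℕ} {r a b : ρ} (h : storeSize σ ≤ s)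
      (h' : storeSize (Function.update σ r (σ a - σ b)) ≤ s) :
      Exec x s (Prog.sub r a b) σ (Function.update σ r (σ a - σ b))
  | mul {σ : ρ → ℕ} {r a b : ρ} (h : storeSize σ ≤ s)
      (h' : storeSize (Function.update σ r (σ a * σ b)) ≤ s) :
      Exec x s (Prog.mul r a b) σ (Function.update σ r (σ a * σ b))
  | div {σ : ρ → ℕ} {r a b : ρ} (h : storeSize σ ≤ s)
      (h' : storeSize (Function.update σ r (σ a / σ b)) ≤ s) :
      Exec x s (Prog.div r a b) σ (Function.update σ r (σ a / σ b))
  | bit {σ : ρ → ℕ} {r a : ρ} (h : storeSize σ ≤ s)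
      (h' : storeSize (Function.update σ r (readBit x (σ a))) ≤ s) :
      Exec x s (Prog.bit r a) σ (Function.update σ r (readBit x (σ a)))
  | seq {σ τ υ : ρ → ℕ} {P Q : Prog ρ} (hP : Exec x s P σ τ) (hQ : Exec x s Q τ υ) :
      Exec x s (Prog.seq P Q) σ υ
  | iteTrue {σ τ : ρ → ℕ} {r : ρ} {P Q : Prog ρ} (hr : σ r ≠ 0) (hP : Exec x s P σ τ) :
      Exec x s (Prog.ite r P Q) σ τ
  | iteFalse {σ τ : ρ → ℕ} {r : ρ} {P Q : Prog ρ} (hr : σ r = 0) (hQ : Exec x s Q σ τ) :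
      Exec x s (Prog.ite r P Q) σ τ
  | loopDone {σ : ρ → ℕ} {r : ρ} {P : Prog ρ} (hr : σ r = 0) (h : storeSize σ ≤ s) :
      Exec x s (Prog.loop r P) σ σ
  | loopStep {σ τ υ : ρ → ℕ} {r : ρ} {P : Prog ρ} (hr : σ r ≠ 0) (hP : Exec x s P σ τ)
      (hL : Exec x s (Prog.loop r P) τ υ) : Exec x s (Prog.loop r P) σ υ

/-- The initial store: the inputs in the first registers, zero in all others. -/
def initStore {k : ℕ} (inputs : List ℕ) : Fin k → ℕ := fun r => inputs.getD r.val 0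

/-- On the given inputs and with read-only string `x`, the program halts with the bit `b` in its
first register and uses space at most `s`. -/
def ComputesBitInSpace {k R : ℕ} (P : Prog (Fin (k + 1))) (inputs : List ℕ) (x : Fin R → Bool)
    (s : ℝ) (b : Bool) : Prop :=
  ∃ (s' : ℕ) (τ : Fin (k + 1) → ℕ), (s' : ℝ) ≤ s ∧ Exec x s' P (initStore inputs) τ ∧
    τ 0 = b.toNat

/-! The rows are independent random sets. Let `q` be the least prime that is at least `n`. A row
consists of the columns `j` at which a random polynomial over `ZMod q` with `k` coefficients has a
value below `3q/(5e)`. By Lagrange interpolation membership is `k`-wise independent, with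
probability `p` about `3/(5e)` (`kWise_polyRow`). A row with fewer than `n/(2e)` ones is replaced by
the full row, so the weight condition always holds. A full row lies in no forbidden set, and by
Chebyshev the replacement is rare.

Isolation (`KWise.good_expect_ge`): for disjoint `T`, `U` with `|T| ≤ e` and `|U| = e`, second-order
Bonferroni shows that a row misses `T` and meets `U` with probability at least `1/40`. By a
Chernoff-type bound and pigeonhole, some column of `U` is then isolated in `t/(100e)` rows.

Bad rows (`KWise.bad_expect_le`): a row inside a forbidden `V` avoids `Vᶜ \ T`, which has at least
`l * e` elements with `l = ⌈40 log(L+1)⌉`. Cut this set into `l` blocks of size `e` and bound the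
indicator of missing a block by the quadratic `1 - u + u(u-1)/2`, where `u` counts the hits. The
product has degree `2l`, so `(e + 2l)`-wise independence evaluates its expectation exactly, even
weighted by `2^|T ∩ X|`. It is exponentially small in `l`, which absorbs the sum over the `L`
forbidden sets. The exponential moment of the number of incidences between `T` and bad rows is
therefore tiny, and Markov's inequality applies.

Both failure probabilities are at most `exp(-t/100000)`, which beats the union bound over at most
`n^(4e)` pairs `(T, U)` because `t ≥ 10^7 e log n`. Coefficients are blocks of `m` random bits
reduced mod `q`; with `2^m ≥ 2qtk` this at most doubles any probability (`bitProb_coefs_le`). A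
positive success probability gives existence.

The program never sees `L`: it derives the block length and `k` from `R`. It evaluates polynomials
by Horner's rule and keeps all registers polynomial in `n`, which is logarithmic space. -/

set_option linter.unusedSectionVars false

/-! ### Reasoning about programs -/

section Programs

variable {ρ : Type} [DecidableEq ρ] [Fintype ρ] {R : ℕ}

/-- All registers hold numbers that are at most `N`. -/
def Fits (N : ℕ) (σ : ρ → ℕ) : Prop := ∀ r, σ r ≤ N

theorem Fits.storeSize_le {N : ℕ} {σ : ρ → ℕ} (h : Fits N σ) :
    storeSize σ ≤ Fintype.card ρ * Nat.size N := by
  unfold storeSize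
  calc ∑ r, Nat.size (σ r) ≤ ∑ _r : ρ, Nat.size N :=
        Finset.sum_le_sum fun r _ => Nat.size_le_size (h r)
    _ = Fintype.card ρ * Nat.size N := by simp

theorem Fits.update {N : ℕ} {σ : ρ → ℕ} (h : Fits N σ) (r : ρ) {v : ℕ} (hv : v ≤ N) :
    Fits N (Function.update σ r v) := by
  intro r'
  by_cases hr : r' = r
  · subst hr; simpa using hv
  · simpa [hr] using h r'

/-- Started in `σ`, the program `P` halts in a store that satisfies `Q`, and all registers stay
at most `N`. -/
def Runs (x : Fin R → Bool) (N : ℕ) (P : Prog ρ) (σ : ρ → ℕ) (Q : (ρ → ℕ) → Prop) : Prop :=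
  Fits N σ → ∃ τ, Exec x (Fintype.card ρ * Nat.size N) P σ τ ∧ Fits N τ ∧ Q τ

variable {x : Fin R → Bool} {N : ℕ} {σ : ρ → ℕ} {Q : (ρ → ℕ) → Prop}

theorem Runs.mono {P : Prog ρ} {Q' : (ρ → ℕ) → Prop} (h : Runs x N P σ Q)
    (hQ : ∀ τ, Fits N τ → Q τ → Q' τ) : Runs x N P σ Q' := fun hσ =>
  let ⟨τ, h₁, h₂, h₃⟩ := h hσ
  ⟨τ, h₁, h₂, hQ τ h₂ h₃⟩

theorem Runs.skip (h : Q σ) : Runs x N Prog.skip σ Q := fun hσ =>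
  ⟨σ, Exec.skip hσ.storeSize_le, hσ, h⟩

theorem Runs.const {r : ρ} {v : ℕ} (hv : v ≤ N) (h : Q (Function.update σ r v)) :
    Runs x N (Prog.const r v) σ Q := fun hσ =>
  ⟨_, Exec.const hσ.storeSize_le (hσ.update r hv).storeSize_le, hσ.update r hv, h⟩

theorem Runs.add {r a b : ρ} (hv : σ a + σ b ≤ N) (h : Q (Function.update σ r (σ a + σ b))) :
    Runs x N (Prog.add r a b) σ Q := fun hσ =>
  ⟨_, Exec.add hσ.storeSize_le (hσ.update r hv).storeSize_le, hσ.update r hv, h⟩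

theorem Runs.sub {r a b : ρ} (h : Q (Function.update σ r (σ a - σ b))) :
    Runs x N (Prog.sub r a b) σ Q := fun hσ =>
  have hv : σ a - σ b ≤ N := (Nat.sub_le _ _).trans (hσ a)
  ⟨_, Exec.sub hσ.storeSize_le (hσ.update r hv).storeSize_le, hσ.update r hv, h⟩

theorem Runs.mul {r a b : ρ} (hv : σ a * σ b ≤ N) (h : Q (Function.update σ r (σ a * σ b))) :
    Runs x N (Prog.mul r a b) σ Q := fun hσ =>
  ⟨_, Exec.mul hσ.storeSize_le (hσ.update r hv).storeSize_le, hσ.update r hv, h⟩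

theorem Runs.div {r a b : ρ} (h : Q (Function.update σ r (σ a / σ b))) :
    Runs x N (Prog.div r a b) σ Q := fun hσ =>
  have hv : σ a / σ b ≤ N := (Nat.div_le_self _ _).trans (hσ a)
  ⟨_, Exec.div hσ.storeSize_le (hσ.update r hv).storeSize_le, hσ.update r hv, h⟩

theorem readBit_le_one (x : Fin R → Bool) (p : ℕ) : readBit x p ≤ 1 := by
  unfold readBit
  split_ifs
  · exact Bool.toNat_le _
  · simp

theorem Runs.bit {r a : ρ} (hN : 1 ≤ N) (h : Q (Function.update σ r (readBit x (σ a)))) :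
    Runs x N (Prog.bit r a) σ Q := fun hσ =>
  have hv : readBit x (σ a) ≤ N := (readBit_le_one x _).trans hN
  ⟨_, Exec.bit hσ.storeSize_le (hσ.update r hv).storeSize_le, hσ.update r hv, h⟩

/-- The postcondition of the first program is the whole correctness claim for the second, so that a
block of instructions is verified by symbolic execution from front to back. -/
theorem Runs.seq {P P' : Prog ρ} (h : Runs x N P σ fun τ => Runs x N P' τ Q) :
    Runs x N (Prog.seq P P') σ Q := fun hσ =>
  let ⟨_, h₁, h₂, h₃⟩ := h hσ
  let ⟨υ, h₄, h₅, h₆⟩ := h₃ h₂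
  ⟨υ, Exec.seq h₁ h₄, h₅, h₆⟩

theorem Runs.ite {r : ρ} {P P' : Prog ρ} (h₁ : σ r ≠ 0 → Runs x N P σ Q)
    (h₂ : σ r = 0 → Runs x N P' σ Q) : Runs x N (Prog.ite r P P') σ Q := fun hσ => by
  by_cases hr : σ r = 0
  · obtain ⟨τ, h⟩ := h₂ hr hσ
    exact ⟨τ, Exec.iteFalse hr h.1, h.2⟩
  · obtain ⟨τ, h⟩ := h₁ hr hσ
    exact ⟨τ, Exec.iteTrue hr h.1, h.2⟩

/-- A loop that makes `K` rounds, with invariant `I u` before round `u`. -/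
theorem Runs.loop {r : ρ} {P : Prog ρ} (K : ℕ) (I : ℕ → (ρ → ℕ) → Prop) (h₀ : I 0 σ)
    (hstep : ∀ u < K, ∀ τ, Fits N τ → I u τ → τ r ≠ 0 ∧ Runs x N P τ (I (u + 1)))
    (hend : ∀ τ, I K τ → τ r = 0) (hQ : ∀ τ, Fits N τ → I K τ → Q τ) :
    Runs x N (Prog.loop r P) σ Q := by
  have key : ∀ v u, u + v = K → ∀ τ, I u τ → Runs x N (Prog.loop r P) τ Q := by
    intro v
    induction v with
    | zero =>
      intro u hu τ hI hτ
      obtain rfl : u = K := by omega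
      exact ⟨τ, Exec.loopDone (hend τ hI) hτ.storeSize_le, hτ, hQ τ hτ hI⟩
    | succ v ih =>
      intro u hu τ hI hτ
      obtain ⟨hr, hrun⟩ := hstep u (by omega) τ hτ hI
      obtain ⟨τ', h₁, h₂, h₃⟩ := hrun hτ
      obtain ⟨υ, h₄, h₅⟩ := ih (u + 1) (by omega) τ' h₃ h₂
      exact ⟨υ, Exec.loopStep hr h₁ h₄, h₅⟩
  exact key K 0 (by omega) σ h₀

/-- The concatenation of a list of programs. -/
def Prog.block : List (Prog ρ) → Prog ρ
  | [] => Prog.skip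
  | [P] => P
  | P :: P' :: l => Prog.seq P (Prog.block (P' :: l))

end Programs

/-! ### The functions computed by the program -/

/-- The number with the `m` binary digits of `x` that start at position `pos`. -/
def blockVal {R : ℕ} (x : Fin R → Bool) (pos : ℕ) : ℕ → ℕ
  | 0 => 0
  | m + 1 => blockVal x pos m + blockVal x pos m + readBit x (pos + m)

theorem blockVal_lt {R : ℕ} (x : Fin R → Bool) (pos m : ℕ) : blockVal x pos m < 2 ^ m := by
  induction m with
  | zero => simp [blockVal]
  | succ m ih =>
    have := readBit_le_one x (pos + m)
    rw [pow_succ, blockVal]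
    omega

/-- The value at `j` modulo `q` of the polynomial with the `k` coefficients that are stored in
`x`, in blocks of `m` bits, from position `base` on. -/
def hashVal {R : ℕ} (x : Fin R → Bool) (base m q j : ℕ) : ℕ → ℕ
  | 0 => 0
  | k + 1 => (hashVal x base m q j k * j + blockVal x (base + k * m) m) % q

theorem hashVal_lt {R : ℕ} (x : Fin R → Bool) (base m j k : ℕ) {q : ℕ} (hq : 0 < q) :
    hashVal x base m q j k < q := by
  cases k with
  | zero => exact hq
  | succ k => exact Nat.mod_lt _ hq

/-- The smallest prime that is at least `n`. -/
noncomputable def primeAbove (n : ℕ) : ℕ :=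
  open Classical in Nat.find (Nat.exists_infinite_primes n)

theorem le_primeAbove (n : ℕ) : n ≤ primeAbove n := by
  classical exact (Nat.find_spec (Nat.exists_infinite_primes n)).1

theorem prime_primeAbove (n : ℕ) : (primeAbove n).Prime := by
  classical exact (Nat.find_spec (Nat.exists_infinite_primes n)).2

theorem primeAbove_le {n p : ℕ} (h : n ≤ p) (hp : p.Prime) : primeAbove n ≤ p := by
  classical exact Nat.find_min' (Nat.exists_infinite_primes n) ⟨h, hp⟩

theorem primeAbove_le_two_mul {n : ℕ} (hn : n ≠ 0) : primeAbove n ≤ 2 * n := by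
  obtain ⟨p, hp, h₁, h₂⟩ := Nat.exists_prime_lt_and_le_two_mul n hn
  exact (primeAbove_le h₁.le hp).trans h₂

theorem Nat.size_div_two {z : ℕ} (hz : z ≠ 0) : (z / 2).size + 1 = z.size := by
  have h := Nat.bit_bodd_div2 z
  have h2 : Nat.bit z.bodd z.div2 ≠ 0 := by rw [h]; exact hz
  have := Nat.size_bit h2
  rw [h, Nat.div2_val] at this
  exact this.symm

/-! ### The program

Registers: `0` to `5` hold the inputs `n, e, t, R, i, j`, then `6` the prime, `7` the block length,
`8` the number of blocks of a row, `9` the position of the first block of the row, `10` the column,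
`11` the weight of the row, `12` the entry in column `j`, `20` the number one, `21` zero. -/

section Program

open Prog

/-- Puts into register `18` whether register `6` has a divisor `d` with `1 < d < q`. -/
def divisorTest : Prog (Fin 24) :=
  block [const 18 0, sub 19 6 20, sub 19 19 20,
    loop 19 (block [add 17 19 20, div 16 6 17, mul 16 16 17, sub 16 6 16,
      ite 16 skip (const 18 1), sub 19 19 20])]

/-- Puts the smallest prime that is at least `n` into register `6`. -/
def primeSearch : Prog (Fin 24) :=
  block [sub 6 0 20, const 18 1, loop 18 (seq (add 6 6 20) divisorTest)]

/-- Puts the number of binary digits of `1000 * n * R` into register `7`. -/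
def lengthSearch : Prog (Fin 24) :=
  block [const 18 1000, mul 18 18 0, mul 18 18 3, const 7 0, const 19 2,
    loop 18 (block [div 18 18 19, add 7 7 20])]

/-- Puts the block at the position in register `14` into register `17`. -/
def readBlock : Prog (Fin 24) :=
  block [const 17 0, add 16 7 21, loop 16 (block [add 17 17 17, bit 18 14, add 17 17 18,
    add 14 14 20, sub 16 16 20])]

/-- Puts the hash value of the column in register `10` into register `15`. -/
def hashColumn : Prog (Fin 24) :=
  block [const 15 0, add 14 9 21, add 13 8 21, loop 13 (block [readBlock, mul 15 15 10,
    add 15 15 17, div 18 15 6, mul 18 18 6, sub 15 15 18, sub 13 13 20])]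

/-- Computes the weight of the row and the entry in column `j`. -/
def scanRow : Prog (Fin 24) :=
  block [const 11 0, const 12 0, add 10 0 21, loop 10 (block [sub 10 10 20, hashColumn,
    const 18 5, mul 18 18 1, mul 18 18 15, const 19 3, mul 19 19 6, sub 18 19 18,
    ite 18 (block [add 11 11 20, sub 18 5 10, sub 19 10 5, add 18 18 19,
      ite 18 skip (const 12 1)]) skip])]

/-- The program that computes the entries of the matrix. -/
def entryProgram : Prog (Fin 24) :=
  block [const 20 1, primeSearch, lengthSearch, mul 18 2 7, div 8 3 18, mul 9 4 8, mul 9 9 7,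
    scanRow, const 18 2, mul 18 18 1, mul 18 18 11, sub 18 0 18, add 0 12 21,
    ite 18 (const 0 1) skip]

variable {R : ℕ} {x : Fin R → Bool} {N : ℕ} {σ : Fin 24 → ℕ}

theorem divisorTest_runs (h20 : σ 20 = 1) (hN : 1 ≤ N) (h6 : 2 ≤ σ 6) :
    Runs x N divisorTest σ fun τ => (τ 18 = 0 ↔ (σ 6).Prime) ∧
      ∀ r, r ∉ [16, 17, 18, 19] → τ r = σ r := by
  refine Runs.seq (Runs.const (by omega) ?_)
  refine Runs.seq (Runs.sub ?_)
  refine Runs.seq (Runs.sub ?_)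
  -- The candidate divisor is register `19` plus one; it descends from `q - 1` to `2`. The flag is
  -- zero as long as no candidate already tried divides `q`. The last clause is the frame condition,
  -- which recurs in all later invariants.
  refine Runs.loop (σ 6 - 2) (fun u τ => τ 19 + u = σ 6 - 2 ∧
    (τ 18 = 0 ↔ ∀ d, τ 19 + 1 < d → d < σ 6 → ¬ d ∣ σ 6) ∧
    ∀ r, r ∉ [16, 17, 18, 19] → τ r = σ r) ?_ ?_ ?_ ?_
  · refine ⟨by simp [h20]; omega, ?_, ?_⟩
    · simp only [h20, Function.update_apply]
      simp
      intro d h₁ h₂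
      omega
    · intro r hr
      simp at hr
      simp [hr]
  · rintro u hu τ hτ ⟨h₁, h₂, h₃⟩
    have e6 : τ 6 = σ 6 := h₃ 6 (by decide)
    have e20 : τ 20 = 1 := (h₃ 20 (by decide)).trans h20
    refine ⟨by omega, ?_⟩
    refine Runs.seq (Runs.add ?_ ?_)
    · have := hτ 6
      omega
    refine Runs.seq (Runs.div ?_)
    refine Runs.seq (Runs.mul ?_ ?_)
    · simp only [Function.update_apply]
      simp
      exact (Nat.div_mul_le_self _ _).trans (hτ 6)
    refine Runs.seq (Runs.sub ?_)
    have hsplit : (∀ d, τ 19 < d → d < σ 6 → ¬ d ∣ σ 6) ↔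
        (∀ d, τ 19 + 1 < d → d < σ 6 → ¬ d ∣ σ 6) ∧ ¬ (τ 19 + 1) ∣ σ 6 := by
      constructor
      · intro h
        exact ⟨fun d hd => h d (by omega), h _ (by omega) (by omega)⟩
      · rintro ⟨h, h'⟩ d hd hd'
        rcases Nat.lt_or_ge (τ 19 + 1) d with hlt | hge
        · exact h d hlt hd'
        · obtain rfl : d = τ 19 + 1 := by omega
          exact h'
    have hdvd : σ 6 - σ 6 / (τ 19 + 1) * (τ 19 + 1) = 0 ↔ (τ 19 + 1) ∣ σ 6 := by
      rw [Nat.dvd_iff_mod_eq_zero]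
      have := Nat.div_add_mod (σ 6) (τ 19 + 1)
      rw [mul_comm] at this
      omega
    refine Runs.seq (Runs.ite ?_ ?_)
    · intro hne
      simp [e6, e20] at hne
      refine Runs.skip (Runs.sub ⟨?_, ?_, ?_⟩)
      · simp [e20]; omega
      · simp [e20]
        rw [h₂, Nat.sub_add_cancel (by omega), hsplit]
        have : ¬ (τ 19 + 1) ∣ σ 6 := by rw [← hdvd]; omega
        tauto
      · intro r hr
        have := h₃ r hr
        simp at hr
        simp [hr, this]
    · intro hne
      simp [e6, e20] at hne
      refine Runs.const hN (Runs.sub ⟨?_, ?_, ?_⟩)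
      · simp [e20]; omega
      · simp [e20]
        have : (τ 19 + 1) ∣ σ 6 := by rw [← hdvd]; omega
        exact ⟨τ 19 + 1, by omega, by omega, this⟩
      · intro r hr
        have := h₃ r hr
        simp at hr
        simp [hr, this]
  · intro τ h
    omega
  · rintro τ - ⟨h₁, h₂, h₃⟩
    refine ⟨?_, h₃⟩
    rw [h₂, Nat.prime_def_lt']
    have : τ 19 = 0 := by omega
    rw [this]
    exact ⟨fun h => ⟨h6, fun d hd => h d (by omega)⟩, fun h d hd => h.2 d (by omega)⟩

theorem primeSearch_runs (h20 : σ 20 = 1) (hN : 2 * σ 0 ≤ N) (h0 : 2 ≤ σ 0) :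
    Runs x N primeSearch σ fun τ => τ 6 = primeAbove (σ 0) ∧
      ∀ r, r ∉ [6, 16, 17, 18, 19] → τ r = σ r := by
  have hp₁ := le_primeAbove (σ 0)
  have hp₂ := primeAbove_le_two_mul (n := σ 0) (by omega)
  refine Runs.seq (Runs.sub ?_)
  refine Runs.seq (Runs.const (by omega) ?_)
  -- The candidate starts at `n - 1` and is incremented before each test, hence the extra round.
  -- Bertrand's postulate keeps it at most `2n`.
  refine Runs.loop (primeAbove (σ 0) - σ 0 + 1) (fun u τ => τ 6 = σ 0 - 1 + u ∧
    (τ 18 = 0 ↔ u = primeAbove (σ 0) - σ 0 + 1) ∧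
    ∀ r, r ∉ [6, 16, 17, 18, 19] → τ r = σ r) ?_ ?_ ?_ ?_
  · refine ⟨by simp [h20], by simp, ?_⟩
    intro r hr
    simp at hr
    simp [hr]
  · rintro u hu τ hτ ⟨h₁, h₂, h₃⟩
    have e20 : τ 20 = 1 := (h₃ 20 (by decide)).trans h20
    refine ⟨by rw [Ne, h₂]; omega, ?_⟩
    refine Runs.seq (Runs.add (by omega) ?_)
    have e6 : τ 6 + τ 20 = σ 0 + u := by omega
    rw [e6]
    refine (divisorTest_runs (by simp [e20]) (by omega) (by simp; omega)).mono ?_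
    rintro υ - ⟨h₄, h₅⟩
    refine ⟨?_, ?_, ?_⟩
    · rw [h₅ 6 (by decide)]
      simp
      omega
    · rw [h₄]
      simp
      constructor
      · intro hp
        have := primeAbove_le (n := σ 0) (p := σ 0 + u) (by omega) hp
        omega
      · intro hu'
        have : σ 0 + u = primeAbove (σ 0) := by omega
        rw [this]
        exact prime_primeAbove _
    · intro r hr
      rw [h₅ r (by simp at hr ⊢; tauto)]
      have := h₃ r hr
      simp at hr
      simp [hr, this]
  · rintro τ ⟨-, h, -⟩
    exact h.2 rfl
  · rintro τ - ⟨h₁, -, h₃⟩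
    exact ⟨by omega, h₃⟩

theorem lengthSearch_runs (h20 : σ 20 = 1) (hN : 1000 * σ 0 * σ 3 + 1000 * σ 0 + 1000 ≤ N) :
    Runs x N lengthSearch σ fun τ => τ 7 = (1000 * σ 0 * σ 3).size ∧
      ∀ r, r ∉ [7, 18, 19] → τ r = σ r := by
  have hsize : (1000 * σ 0 * σ 3).size ≤ 1000 * σ 0 * σ 3 := by
    rw [Nat.size_le]
    exact Nat.lt_two_pow_self
  refine Runs.seq (Runs.const (by omega) ?_)
  refine Runs.seq (Runs.mul (by simp; omega) ?_)
  refine Runs.seq (Runs.mul (by simp; omega) ?_)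
  refine Runs.seq (Runs.const (by omega) ?_)
  refine Runs.seq (Runs.const (by omega) ?_)
  -- Each halving removes one binary digit, so digits left plus rounds made is constant.
  refine Runs.loop (1000 * σ 0 * σ 3).size (fun u τ => τ 7 = u ∧ τ 19 = 2 ∧
    (τ 18).size + u = (1000 * σ 0 * σ 3).size ∧
    ∀ r, r ∉ [7, 18, 19] → τ r = σ r) ?_ ?_ ?_ ?_
  · refine ⟨by simp, by simp, by simp, ?_⟩
    intro r hr
    simp at hr
    simp [hr]
  · rintro u hu τ hτ ⟨h₁, h₂, h₃, h₄⟩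
    have e20 : τ 20 = 1 := (h₄ 20 (by decide)).trans h20
    have hne : τ 18 ≠ 0 := by
      intro h
      rw [h] at h₃
      simp at h₃
      omega
    refine ⟨hne, ?_⟩
    refine Runs.seq (Runs.div ?_)
    refine Runs.add (by simp; omega) ⟨by simp; omega, by simp [h₂], ?_, ?_⟩
    · simp [h₂]
      have := Nat.size_div_two hne
      omega
    · intro r hr
      have := h₄ r hr
      simp at hr
      simp [hr, this]
  · rintro τ ⟨-, -, h, -⟩
    exact Nat.size_eq_zero.1 (by omega)
  · rintro τ - ⟨h₁, -, -, h₃⟩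
    exact ⟨h₁, h₃⟩

theorem readBlock_runs (h20 : σ 20 = 1) (h21 : σ 21 = 0) (hN : 2 ^ σ 7 + σ 14 + σ 7 ≤ N) :
    Runs x N readBlock σ fun τ => τ 17 = blockVal x (σ 14) (σ 7) ∧ τ 14 = σ 14 + σ 7 ∧
      ∀ r, r ∉ [14, 16, 17, 18] → τ r = σ r := by
  have hpos : 1 ≤ 2 ^ σ 7 := Nat.one_le_two_pow
  refine Runs.seq (Runs.const (by omega) ?_)
  refine Runs.seq (Runs.add (by simp; omega) ?_)
  refine Runs.loop (σ 7) (fun u τ => τ 17 = blockVal x (σ 14) u ∧ τ 14 = σ 14 + u ∧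
    τ 16 + u = σ 7 ∧ ∀ r, r ∉ [14, 16, 17, 18] → τ r = σ r) ?_ ?_ ?_ ?_
  · refine ⟨by simp [blockVal], by simp, by simp [h21], ?_⟩
    intro r hr
    simp at hr
    simp [hr]
  · rintro u hu τ hτ ⟨h₁, h₂, h₃, h₄⟩
    have e20 : τ 20 = 1 := (h₄ 20 (by decide)).trans h20
    have hlt := blockVal_lt x (σ 14) (u + 1)
    have hle : 2 ^ (u + 1) ≤ 2 ^ σ 7 := Nat.pow_le_pow_right (by omega) hu
    rw [blockVal] at hlt
    refine ⟨by omega, ?_⟩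
    refine Runs.seq (Runs.add (by omega) ?_)
    refine Runs.seq (Runs.bit (by omega) ?_)
    refine Runs.seq (Runs.add (by simp [h₁, h₂]; omega) ?_)
    refine Runs.seq (Runs.add (by simp; omega) ?_)
    refine Runs.sub ⟨by simp [h₁, h₂, blockVal], by simp [h₂, e20]; omega, by simp [e20]; omega, ?_⟩
    intro r hr
    have := h₄ r hr
    simp at hr
    simp [hr, this]
  · rintro τ ⟨-, -, h, -⟩
    omega
  · rintro τ - ⟨h₁, h₂, -, h₃⟩
    exact ⟨h₁, h₂, h₃⟩

theorem hashColumn_runs (h20 : σ 20 = 1) (h21 : σ 21 = 0) (hq : 0 < σ 6)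
    (hN : 2 ^ σ 7 + σ 9 + σ 8 * σ 7 + σ 6 * σ 10 ≤ N) (h8 : σ 8 ≤ N) :
    Runs x N hashColumn σ fun τ => τ 15 = hashVal x (σ 9) (σ 7) (σ 6) (σ 10) (σ 8) ∧
      ∀ r, r ∉ [13, 14, 15, 16, 17, 18] → τ r = σ r := by
  have hpos : 1 ≤ 2 ^ σ 7 := Nat.one_le_two_pow
  refine Runs.seq (Runs.const (by omega) ?_)
  refine Runs.seq (Runs.add (by simp [h21]; omega) ?_)
  refine Runs.seq (Runs.add (by simp [h21]; omega) ?_)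
  -- Horner's rule, leading coefficient first: the bit position only moves forward, since
  -- `readBlock` leaves it at the start of the next block.
  refine Runs.loop (σ 8) (fun u τ => τ 15 = hashVal x (σ 9) (σ 7) (σ 6) (σ 10) u ∧
    τ 14 = σ 9 + u * σ 7 ∧ τ 13 + u = σ 8 ∧
    ∀ r, r ∉ [13, 14, 15, 16, 17, 18] → τ r = σ r) ?_ ?_ ?_ ?_
  · refine ⟨by simp [hashVal], by simp [h21], by simp [h21], ?_⟩
    intro r hr
    simp at hr
    simp [hr]
  · rintro u hu τ hτ ⟨h₁, h₂, h₃, h₄⟩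
    have e20 : τ 20 = 1 := (h₄ 20 (by decide)).trans h20
    have e21 : τ 21 = 0 := (h₄ 21 (by decide)).trans h21
    have e6 : τ 6 = σ 6 := h₄ 6 (by decide)
    have e7 : τ 7 = σ 7 := h₄ 7 (by decide)
    have e10 : τ 10 = σ 10 := h₄ 10 (by decide)
    have hlt := hashVal_lt x (σ 9) (σ 7) (σ 10) u hq
    have hmul : hashVal x (σ 9) (σ 7) (σ 6) (σ 10) u * σ 10 ≤ σ 6 * σ 10 :=
      Nat.mul_le_mul_right _ hlt.le
    have hmul' : u * σ 7 + σ 7 ≤ σ 8 * σ 7 := by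
      rw [← Nat.succ_mul]
      exact Nat.mul_le_mul_right _ hu
    have hb := blockVal_lt x (σ 9 + u * σ 7) (σ 7)
    refine ⟨by omega, ?_⟩
    refine Runs.seq ((readBlock_runs e20 e21 (by rw [e7, h₂]; omega)).mono ?_)
    rintro υ hυ ⟨k₁, k₂, k₃⟩
    rw [h₂, e7] at k₁ k₂
    have f6 : υ 6 = σ 6 := by rw [k₃ 6 (by decide), e6]
    have f10 : υ 10 = σ 10 := by rw [k₃ 10 (by decide), e10]
    have f20 : υ 20 = 1 := by rw [k₃ 20 (by decide), e20]
    have f15 : υ 15 = hashVal x (σ 9) (σ 7) (σ 6) (σ 10) u := by rw [k₃ 15 (by decide), h₁]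
    have f13 : υ 13 = τ 13 := k₃ 13 (by decide)
    refine Runs.seq (Runs.mul (by rw [f15, f10]; omega) ?_)
    refine Runs.seq (Runs.add (by simp [f15, f10, k₁]; omega) ?_)
    refine Runs.seq (Runs.div ?_)
    refine Runs.seq (Runs.mul ?_ ?_)
    · simp [f15, f10, k₁]
      refine (Nat.div_mul_le_self _ _).trans (by omega)
    refine Runs.seq (Runs.sub ?_)
    refine Runs.sub ⟨?_, ?_, ?_, ?_⟩
    · simp [f15, f10, k₁, f6, hashVal]
      have := Nat.div_add_mod (hashVal x (σ 9) (σ 7) (σ 6) (σ 10) u * σ 10 +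
        blockVal x (σ 9 + u * σ 7) (σ 7)) (σ 6)
      rw [mul_comm] at this
      omega
    · simp [k₂]
      ring
    · simp [f13, f20]
      omega
    · intro r hr
      have := h₄ r hr
      have hk := k₃ r (by simp at hr ⊢; tauto)
      simp at hr
      simp [hr, this, hk]
  · rintro τ ⟨-, -, h, -⟩
    omega
  · rintro τ - ⟨h₁, -, -, h₃⟩
    exact ⟨h₁, h₃⟩

/-- The columns in which the row with coefficients at position `base` has a one. -/
def hashRow {R : ℕ} (x : Fin R → Bool) (base m q k e : ℕ) (s : Finset ℕ) : Finset ℕ :=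
  s.filter fun j => 5 * e * hashVal x base m q j k < 3 * q

theorem scanRow_runs (h20 : σ 20 = 1) (h21 : σ 21 = 0) (hq : 0 < σ 6) (h8 : σ 8 ≤ N)
    (hN : 2 ^ σ 7 + σ 9 + σ 8 * σ 7 + σ 6 * σ 0 + 5 * σ 1 * σ 6 + 5 * σ 1 + 3 * σ 6 + 5 ≤ N)
    (h5 : σ 5 < σ 0) :
    Runs x N scanRow σ fun τ =>
      τ 11 = (hashRow x (σ 9) (σ 7) (σ 6) (σ 8) (σ 1) (Finset.range (σ 0))).card ∧
      τ 12 = (decide (5 * σ 1 * hashVal x (σ 9) (σ 7) (σ 6) (σ 5) (σ 8) < 3 * σ 6)).toNat ∧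
      ∀ r, r ∉ [10, 11, 12, 13, 14, 15, 16, 17, 18, 19] → τ r = σ r := by
  have hpos : 1 ≤ 2 ^ σ 7 := Nat.one_le_two_pow
  have h0N : σ 0 ≤ σ 6 * σ 0 := Nat.le_mul_of_pos_left _ hq
  refine Runs.seq (Runs.const (by omega) ?_)
  refine Runs.seq (Runs.const (by omega) ?_)
  refine Runs.seq (Runs.add (by simp [h21]; omega) ?_)
  -- Columns are scanned downwards, so those already treated form `Ico (τ 10) n`. The entry register
  -- can be nonzero only once column `j` has been passed.
  refine Runs.loop (σ 0) (fun u τ => τ 10 + u = σ 0 ∧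
    τ 11 = (hashRow x (σ 9) (σ 7) (σ 6) (σ 8) (σ 1) (Finset.Ico (τ 10) (σ 0))).card ∧
    τ 12 = (decide (τ 10 ≤ σ 5 ∧
      5 * σ 1 * hashVal x (σ 9) (σ 7) (σ 6) (σ 5) (σ 8) < 3 * σ 6)).toNat ∧
    ∀ r, r ∉ [10, 11, 12, 13, 14, 15, 16, 17, 18, 19] → τ r = σ r) ?_ ?_ ?_ ?_
  · refine ⟨by simp [h21], by simp [h21, hashRow], ?_, ?_⟩
    · simp [h21, Nat.not_le.2 h5]
    · intro r hr
      simp at hr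
      simp [hr]
  · rintro u hu τ hτ ⟨h₁, h₂, h₃, h₄⟩
    have e0 : τ 0 = σ 0 := h₄ 0 (by decide)
    have e1 : τ 1 = σ 1 := h₄ 1 (by decide)
    have e5 : τ 5 = σ 5 := h₄ 5 (by decide)
    have e6 : τ 6 = σ 6 := h₄ 6 (by decide)
    have e7 : τ 7 = σ 7 := h₄ 7 (by decide)
    have e8 : τ 8 = σ 8 := h₄ 8 (by decide)
    have e9 : τ 9 = σ 9 := h₄ 9 (by decide)
    have e20 : τ 20 = 1 := (h₄ 20 (by decide)).trans h20
    have e21 : τ 21 = 0 := (h₄ 21 (by decide)).trans h21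
    refine ⟨by omega, ?_⟩
    obtain ⟨v, hv⟩ : ∃ v, τ 10 = v + 1 := ⟨τ 10 - 1, by omega⟩
    have hvn : v < σ 0 := by omega
    refine Runs.seq (Runs.sub ?_)
    simp only [hv, e20, Nat.add_sub_cancel]
    have hmul : σ 6 * v ≤ σ 6 * σ 0 := Nat.mul_le_mul_left _ hvn.le
    refine Runs.seq ((hashColumn_runs (by simp [e20]) (by simp [e21]) (by simp [e6, hq])
      (by simp [e6, e7, e8, e9]; omega) (by simp [e8, h8])).mono ?_)
    rintro υ hυ ⟨k₁, k₂⟩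
    simp [e6, e7, e8, e9] at k₁
    set h := hashVal x (σ 9) (σ 7) (σ 6) v (σ 8) with hh
    have hlt : h < σ 6 := hashVal_lt x (σ 9) (σ 7) v (σ 8) hq
    have f1 : υ 1 = σ 1 := by rw [k₂ 1 (by decide)]; simp [e1]
    have f5 : υ 5 = σ 5 := by rw [k₂ 5 (by decide)]; simp [e5]
    have f6 : υ 6 = σ 6 := by rw [k₂ 6 (by decide)]; simp [e6]
    have f10 : υ 10 = v := by rw [k₂ 10 (by decide)]; simp
    have f11 : υ 11 = τ 11 := by rw [k₂ 11 (by decide)]; simp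
    have f12 : υ 12 = τ 12 := by rw [k₂ 12 (by decide)]; simp
    have f20 : υ 20 = 1 := by rw [k₂ 20 (by decide)]; simp [e20]
    have hmul' : 5 * σ 1 * h ≤ 5 * σ 1 * σ 6 := Nat.mul_le_mul_left _ hlt.le
    refine Runs.seq (Runs.const (by omega) ?_)
    refine Runs.seq (Runs.mul (by simp [f1]; omega) ?_)
    refine Runs.seq (Runs.mul (by simp [f1, k₁]; omega) ?_)
    refine Runs.seq (Runs.const (by omega) ?_)
    refine Runs.seq (Runs.mul (by simp [f6]; omega) ?_)
    refine Runs.seq (Runs.sub ?_)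
    have hIco : Finset.Ico v (σ 0) = insert v (Finset.Ico (v + 1) (σ 0)) :=
      (Finset.insert_Ico_add_one_left_eq_Ico hvn).symm
    rw [hv] at h₂ h₃
    have hcard : (hashRow x (σ 9) (σ 7) (σ 6) (σ 8) (σ 1) (Finset.Ico v (σ 0))).card =
        τ 11 + (decide (5 * σ 1 * h < 3 * σ 6)).toNat := by
      rw [h₂, hashRow, hIco, Finset.filter_insert]
      split_ifs with hif
      · rw [Finset.card_insert_of_notMem (by simp)]
        simp [hashRow, hh, hif]
      · simp [hashRow, hh, hif]
    have hcard' : τ 11 ≤ σ 0 := by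
      rw [h₂, hashRow]
      refine (Finset.card_filter_le _ _).trans ?_
      simp
    have hframe : ∀ r, r ∉ [10, 11, 12, 13, 14, 15, 16, 17, 18, 19] → υ r = σ r := by
      intro r hr
      have hk := k₂ r (by simp at hr ⊢; tauto)
      have := h₄ r hr
      simp at hr
      rw [hk]
      simp [hr, this]
    refine Runs.ite ?_ ?_
    · intro hne
      simp [f1, f6, k₁] at hne
      have hlt' : 5 * σ 1 * h < 3 * σ 6 := by omega
      refine Runs.seq (Runs.add (by simp [f11, f20]; omega) ?_)
      -- The sum of the two truncated differences is zero exactly when the scanned column is column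
      -- `j`; this is the equality test.
      refine Runs.seq (Runs.sub ?_)
      refine Runs.seq (Runs.sub ?_)
      refine Runs.seq (Runs.add ?_ ?_)
      · simp [f5, f10]
        omega
      refine Runs.ite ?_ ?_
      · intro hne'
        simp [f5, f10] at hne'
        have hne2 : v ≠ σ 5 := by omega
        refine Runs.skip ⟨by simp [f10]; omega, by simp [f10, f11, f20, hcard, hlt'], ?_, ?_⟩
        · simp [f10, f12, h₃]
          have : v < σ 5 ↔ v ≤ σ 5 := by omega
          simp [this]
        · intro r hr
          have := hframe r hr
          simp at hr
          simp [hr, this]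
      · intro heq
        simp [f5, f10] at heq
        have heq2 : v = σ 5 := by omega
        refine Runs.const (by omega)
          ⟨by simp [f10]; omega, by simp [f10, f11, f20, hcard, hlt'], ?_, ?_⟩
        · rw [heq2] at hh
          simp [f10, heq2, ← hh, hlt']
        · intro r hr
          have := hframe r hr
          simp at hr
          simp [hr, this]
    · intro heq
      simp [f1, f6, k₁] at heq
      have hge : ¬ 5 * σ 1 * h < 3 * σ 6 := by omega
      refine Runs.skip ⟨by simp [f10]; omega, by simp [f10, f11, hcard, hge], ?_, ?_⟩
      · simp [f10, f12, h₃]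
        rcases eq_or_ne v (σ 5) with rfl | hne
        · simp [← hh, hge]
        · have : v < σ 5 ↔ v ≤ σ 5 := by omega
          simp [this]
      · intro r hr
        have := hframe r hr
        simp at hr
        simp [hr, this]
  · rintro τ ⟨h, -⟩
    omega
  · rintro τ - ⟨h₁, h₂, h₃, h₄⟩
    have : τ 10 = 0 := by omega
    rw [this] at h₂ h₃
    exact ⟨by rw [h₂, Finset.range_eq_Ico], by simpa using h₃, h₄⟩

/-- The entry in row `i` and column `j` of the matrix computed from `x`: rows of weight less than
`n / (2 * e)` are replaced by rows of ones. -/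
noncomputable def hashEntry {R : ℕ} (x : Fin R → Bool) (n e t i j : ℕ) : Bool :=
  let m := (1000 * n * R).size
  let k := R / (t * m)
  let q := primeAbove n
  decide (5 * e * hashVal x (i * k * m) m q j k < 3 * q) ||
    decide (2 * e * (hashRow x (i * k * m) m q k e (Finset.range n)).card < n)

/-- Row `i` owns the bits from `i * k * m` to `(i + 1) * k * m`, which lie inside the string because
`t * k * m ≤ R`. Every intermediate value is at most `10000 * n ^ 2 * (R + 1)`, and there are 24
registers. -/
theorem entryProgram_computes {n e t i j : ℕ} (hn : 2 ≤ n) (hi : i < t) (hj : j < n)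
    (he : e ≤ n) (ht : t ≤ n) :
    ComputesBitInSpace entryProgram [n, e, t, R, i, j] x
      ((24 * Nat.size (10000 * n ^ 2 * (R + 1)) : ℕ) : ℝ) (hashEntry x n e t i j) := by
  set N := 10000 * n ^ 2 * (R + 1) with hN
  suffices h : Runs x N entryProgram (initStore [n, e, t, R, i, j])
      fun τ => τ 0 = (hashEntry x n e t i j).toNat by
    obtain ⟨τ, h₁, -, h₃⟩ := h fun r => by
      have h2 : 1 ≤ n ^ 2 := Nat.one_le_pow _ _ (by omega)
      have h1 : n ≤ n ^ 2 := Nat.le_self_pow (by omega) n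
      have h3 : n ^ 2 + R ≤ n ^ 2 * (R + 1) := by nlinarith
      have h4 : n ^ 2 + R ≤ N := by rw [hN, mul_assoc]; omega
      unfold initStore
      fin_cases r <;> simp <;> omega
    exact ⟨_, τ, le_rfl, by simpa using h₁, h₃⟩
  have h2 : 1 ≤ n ^ 2 := Nat.one_le_pow _ _ (by omega)
  have h1 : n ≤ n ^ 2 := Nat.le_self_pow (by omega) n
  have hnR : n * R ≤ n ^ 2 * R := Nat.mul_le_mul_right _ h1
  have hN' : N = 10000 * (n ^ 2 * R) + 10000 * n ^ 2 := by rw [hN]; ring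
  have hR : R ≤ n ^ 2 * R := Nat.le_mul_of_pos_left _ h2
  have hen : e * n ≤ n ^ 2 := by nlinarith
  have hq₁ := le_primeAbove n
  have hq₂ := primeAbove_le_two_mul (n := n) (by omega)
  have hqn : primeAbove n * n ≤ 2 * n ^ 2 := by nlinarith
  have heq : 5 * e * primeAbove n ≤ 10 * n ^ 2 := by nlinarith
  have hm₁ : (1000 * n * R).size ≤ 1000 * (n * R) := by
    rw [Nat.size_le, ← mul_assoc]
    exact Nat.lt_two_pow_self
  -- A block of `m` bits is a number of the order of `n * R`, so it costs only logarithmic space.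
  have hm₂ : 2 ^ (1000 * n * R).size ≤ 2000 * (n * R) + 1 := by
    rcases Nat.eq_zero_or_pos (1000 * n * R) with h0 | h0
    · simp [h0]
    · have hs : 0 < (1000 * n * R).size := Nat.size_pos.2 h0
      obtain ⟨s, hs'⟩ : ∃ s, (1000 * n * R).size = s + 1 := ⟨_, (Nat.sub_add_cancel hs).symm⟩
      have : 2 ^ s ≤ 1000 * n * R := by
        rw [← Nat.lt_size]
        omega
      rw [hs', pow_succ]
      rw [mul_assoc] at this
      omega
  have htm : t * (1000 * n * R).size ≤ 1000 * (n ^ 2 * R) := by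
    calc _ ≤ n * (1000 * (n * R)) := Nat.mul_le_mul ht hm₁
      _ = _ := by ring
  set m := (1000 * n * R).size with hm
  set k := R / (t * m) with hk
  have hkR : k ≤ R := Nat.div_le_self _ _
  have hkm : t * k * m ≤ R := by
    calc t * k * m = R / (t * m) * (t * m) := by rw [hk]; ring
      _ ≤ R := Nat.div_mul_le_self _ _
  have hik : i * k ≤ n ^ 2 * R := by
    calc i * k ≤ n * R := Nat.mul_le_mul (by omega) hkR
      _ ≤ _ := hnR
  have hikm : i * k * m + k * m ≤ R := by
    refine le_trans ?_ hkm
    have : (i + 1) * (k * m) ≤ t * (k * m) := Nat.mul_le_mul_right _ hi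
    calc i * k * m + k * m = (i + 1) * (k * m) := by ring
      _ ≤ t * (k * m) := this
      _ = _ := by ring
  refine Runs.seq (Runs.const (by omega) ?_)
  refine Runs.seq ((primeSearch_runs (by simp) (by simp [initStore]; omega)
    (by simpa [initStore] using hn)).mono ?_)
  rintro τ hτ ⟨h₁, h₂⟩
  refine Runs.seq ((lengthSearch_runs (by simp [h₂]) ?_).mono ?_)
  · simp [h₂, initStore]
    rw [mul_assoc]
    omega
  rintro υ hυ ⟨k₁, k₂⟩
  have a0 : υ 0 = n := by simp [k₂, h₂, initStore]
  have a1 : υ 1 = e := by simp [k₂, h₂, initStore]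
  have a2 : υ 2 = t := by simp [k₂, h₂, initStore]
  have a3 : υ 3 = R := by simp [k₂, h₂, initStore]
  have a4 : υ 4 = i := by simp [k₂, h₂, initStore]
  have a5 : υ 5 = j := by simp [k₂, h₂, initStore]
  have a6 : υ 6 = primeAbove n := by simp [k₂, h₁, initStore]
  have a7 : υ 7 = m := by simp [k₁, h₂, initStore, hm]
  have a20 : υ 20 = 1 := by simp [k₂, h₂]
  have a21 : υ 21 = 0 := by simp [k₂, h₂, initStore]
  refine Runs.seq (Runs.mul (by simp [a2, a7]; omega) ?_)
  refine Runs.seq (Runs.div ?_)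
  refine Runs.seq (Runs.mul ?_ ?_)
  · simp [a2, a3, a4, a7, ← hk]
    omega
  refine Runs.seq (Runs.mul ?_ ?_)
  · simp [a2, a3, a4, a7, ← hk]
    omega
  simp [a2, a3, a4, a7, ← hk]
  refine Runs.seq ((scanRow_runs ?_ ?_ ?_ ?_ ?_ ?_).mono ?_)
  · simp [a20]
  · simp [a21]
  · simp [a6, (prime_primeAbove n).pos]
  · simp
    omega
  · simp [a0, a1, a6, a7]
    omega
  · simp [a0, a5, hj]
  rintro φ hφ ⟨l₁, l₂, l₃⟩
  simp [a0, a1, a5, a6, a7] at l₁ l₂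
  have b0 : φ 0 = n := by simp [l₃, a0]
  have b1 : φ 1 = e := by simp [l₃, a1]
  have b21 : φ 21 = 0 := by simp [l₃, a21]
  have hcard : (hashRow x (i * k * m) m (primeAbove n) k e (Finset.range n)).card ≤ n := by
    refine (Finset.card_filter_le _ _).trans ?_
    simp
  have hcard' : 2 * e * (hashRow x (i * k * m) m (primeAbove n) k e (Finset.range n)).card ≤
      2 * n ^ 2 := by
    calc _ ≤ 2 * e * n := Nat.mul_le_mul_left _ hcard
      _ ≤ _ := by rw [mul_assoc]; omega
  refine Runs.seq (Runs.const (by omega) ?_)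
  refine Runs.seq (Runs.mul (by simp [b1]; omega) ?_)
  refine Runs.seq (Runs.mul (by simp [b1, l₁]; omega) ?_)
  refine Runs.seq (Runs.sub ?_)
  refine Runs.seq (Runs.add (by simp [l₂, b21]; have := Bool.toNat_le (decide (5 * e * hashVal x (i * k * m) m (primeAbove n) j k < 3 * primeAbove n)); omega) ?_)
  simp [b0, b1, b21, l₁, l₂]
  refine Runs.ite ?_ ?_
  · intro hne
    simp at hne
    refine Runs.const (by omega) ?_
    have hlt : 2 * e * (hashRow x (i * k * m) m (primeAbove n) k e (Finset.range n)).card < n := by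
      omega
    simp [hashEntry, ← hm, ← hk, hlt]
  · intro heq
    simp at heq
    refine Runs.skip ?_
    simp [hashEntry, ← hm, ← hk, Nat.not_lt.2 (Nat.sub_eq_zero_iff_le.1 heq)]

end Program

/-! ### Random subsets with limited independence -/

section RandomSubset

open Finset
open scoped BigOperators

variable {Ω : Type} [Fintype Ω] {n k e : ℕ} {p : ℝ} {X : Ω → Finset (Fin n)}

/-- The indicator of membership in a random set. -/
noncomputable def ind (X : Ω → Finset (Fin n)) (ω : Ω) (a : Fin n) : ℝ :=
  if a ∈ X ω then 1 else 0

/-- Every element is in the random set `X` with probability `p`, `k`-wise independently. -/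
def KWise (k : ℕ) (p : ℝ) (X : Ω → Finset (Fin n)) : Prop :=
  ∀ A : Finset (Fin n), A.card ≤ k → 𝔼 ω, ∏ a ∈ A, ind X ω a = p ^ A.card

theorem sum_ind (X : Ω → Finset (Fin n)) (ω : Ω) (S : Finset (Fin n)) :
    ∑ a ∈ S, ind X ω a = ((S ∩ X ω).card : ℝ) := by
  simp [ind, Finset.sum_ite_mem]

theorem prod_ind (X : Ω → Finset (Fin n)) (ω : Ω) (A : Finset (Fin n)) :
    ∏ a ∈ A, ind X ω a = if A ⊆ X ω then 1 else 0 := by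
  unfold ind
  split_ifs with h
  · exact Finset.prod_eq_one fun a ha => if_pos (h ha)
  · obtain ⟨a, ha, ha'⟩ := Finset.not_subset.1 h
    exact Finset.prod_eq_zero ha (if_neg ha')

theorem sum_pairs (X : Ω → Finset (Fin n)) (ω : Ω) (S : Finset (Fin n)) :
    ∑ P ∈ S.powersetCard 2, ∏ a ∈ P, ind X ω a = (((S ∩ X ω).card.choose 2 : ℕ) : ℝ) := by
  simp_rw [prod_ind]
  rw [Finset.sum_boole, ← Finset.card_powersetCard]
  congr 2
  ext P
  simp [Finset.mem_powersetCard, Finset.subset_inter_iff]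
  tauto

/-- This writes the exponential moment `2^|T ∩ X|` as a polynomial in the indicators, of degree
`|T|`, which is what limited independence can evaluate. -/
theorem prod_one_add_ind (X : Ω → Finset (Fin n)) (ω : Ω) (T : Finset (Fin n)) :
    ∏ a ∈ T, (1 + ind X ω a) = 2 ^ (T ∩ X ω).card := by
  have : ∀ a ∈ T, 1 + ind X ω a = if a ∈ X ω then (2 : ℝ) else 1 := by
    intro a _
    unfold ind
    split_ifs <;> norm_num
  rw [Finset.prod_congr rfl this, Finset.prod_ite_mem, Finset.prod_const]

theorem KWise.expect_sum (h : KWise k p X) (hk : 1 ≤ k) (S : Finset (Fin n)) :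
    𝔼 ω, ∑ a ∈ S, ind X ω a = S.card * p := by
  rw [Finset.expect_sum_comm]
  have : ∀ a ∈ S, 𝔼 ω, ind X ω a = p := by
    intro a _
    simpa using h {a} (by simpa using hk)
  rw [Finset.sum_congr rfl this]
  simp

theorem KWise.expect_pairs (h : KWise k p X) (hk : 2 ≤ k) (S : Finset (Fin n)) :
    𝔼 ω, ∑ P ∈ S.powersetCard 2, ∏ a ∈ P, ind X ω a = (S.card : ℝ) * (S.card - 1) / 2 * p ^ 2 := by
  rw [Finset.expect_sum_comm]
  have : ∀ P ∈ S.powersetCard 2, 𝔼 ω, ∏ a ∈ P, ind X ω a = p ^ 2 := by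
    intro P hP
    rw [h P (by rw [(Finset.mem_powersetCard.1 hP).2]; exact hk),
      (Finset.mem_powersetCard.1 hP).2]
  rw [Finset.sum_congr rfl this]
  simp [Nat.cast_choose_two]

theorem KWise.expect_cross (h : KWise k p X) (hk : 2 ≤ k) {S T : Finset (Fin n)}
    (hST : Disjoint S T) :
    𝔼 ω, (∑ a ∈ S, ind X ω a) * ∑ b ∈ T, ind X ω b = S.card * T.card * p ^ 2 := by
  simp_rw [Finset.sum_mul_sum]
  rw [Finset.expect_sum_comm]
  have : ∀ a ∈ S, 𝔼 ω, ∑ b ∈ T, ind X ω a * ind X ω b = T.card * p ^ 2 := by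
    intro a ha
    rw [Finset.expect_sum_comm]
    have : ∀ b ∈ T, 𝔼 ω, ind X ω a * ind X ω b = p ^ 2 := by
      intro b hb
      have hab : a ≠ b := fun h => Finset.disjoint_left.1 hST ha (h ▸ hb)
      have := h {a, b} (by rw [Finset.card_pair hab]; exact hk)
      simpa [Finset.prod_pair hab, Finset.card_pair hab] using this
    rw [Finset.sum_congr rfl this]
    simp
  rw [Finset.sum_congr rfl this]
  simp
  ring

/-- `k`-wise independence makes it unlikely that a set of `l * e` elements is avoided. -/
theorem KWise.exists_dominating (h : KWise k p X) (e l : ℕ) (S : Finset (Fin n))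
    (hS : l * e ≤ S.card) :
    ∃ ψ : Ω → ℝ, (∀ ω, 0 ≤ ψ ω) ∧ (∀ ω, Disjoint S (X ω) → 1 ≤ ψ ω) ∧
      ∀ A : Finset (Fin n), Disjoint A S → A.card + 2 * l ≤ k →
        𝔼 ω, (∏ a ∈ A, ind X ω a) * ψ ω =
          p ^ A.card * (1 - e * p + (e : ℝ) * (e - 1) / 2 * p ^ 2) ^ l := by
  induction l generalizing S with
  | zero =>
    refine ⟨fun _ => 1, by simp, by simp, ?_⟩
    intro A _ hA
    simpa using h A (by omega)
  | succ l ih =>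
    obtain ⟨S₁, hS₁, hcard⟩ := Finset.exists_subset_card_eq
      (show e ≤ S.card by rw [Nat.succ_mul] at hS; omega)
    obtain ⟨ψ, h₁, h₂, h₃⟩ := ih (S \ S₁) (by
      rw [Finset.card_sdiff_of_subset hS₁, hcard]
      rw [Nat.succ_mul] at hS
      omega)
    -- With `u` hits in the block `S₁` the new factor is `1 - u + u(u-1)/2`: nonnegative, equal to
    -- one at `u = 0`, and of degree two. Each block thus uses up two units of independence.
    refine ⟨fun ω => (1 - ∑ a ∈ S₁, ind X ω a +
      ∑ P ∈ S₁.powersetCard 2, ∏ a ∈ P, ind X ω a) * ψ ω, ?_, ?_, ?_⟩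
    · intro ω
      refine mul_nonneg ?_ (h₁ ω)
      rw [sum_ind, sum_pairs, Nat.cast_choose_two]
      rcases Nat.lt_or_ge (S₁ ∩ X ω).card 2 with hlt | hge
      · interval_cases (S₁ ∩ X ω).card <;> norm_num
      · have : (2 : ℝ) ≤ (S₁ ∩ X ω).card := by exact_mod_cast hge
        nlinarith
    · intro ω hω
      have hdis : S₁ ∩ X ω = ∅ :=
        Finset.disjoint_iff_inter_eq_empty.1 (Finset.disjoint_of_subset_left hS₁ hω)
      beta_reduce
      rw [sum_ind, sum_pairs, hdis]
      simpa using h₂ ω (Finset.disjoint_of_subset_left Finset.sdiff_subset hω)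
    · intro A hA hAk
      have hAS₁ : Disjoint A S₁ := Finset.disjoint_of_subset_right hS₁ hA
      -- Monomials of the new factor are absorbed into `A`; this is why the claim is proved for all
      -- `A` and not only for the empty set.
      have key : ∀ B : Finset (Fin n), B ⊆ S₁ → B.card ≤ 2 →
          𝔼 ω, (∏ a ∈ A, ind X ω a) * (∏ a ∈ B, ind X ω a) * ψ ω =
            p ^ A.card * p ^ B.card * (1 - e * p + (e : ℝ) * (e - 1) / 2 * p ^ 2) ^ l := by
        intro B hB hB2
        have hAB : Disjoint A B := Finset.disjoint_of_subset_right hB hAS₁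
        have := h₃ (A ∪ B) ?_ ?_
        · rw [Finset.card_union_of_disjoint hAB, pow_add] at this
          rw [← this]
          refine Finset.expect_congr rfl fun ω _ => ?_
          rw [Finset.prod_union hAB]
        · rw [Finset.disjoint_union_left]
          exact ⟨Finset.disjoint_of_subset_right Finset.sdiff_subset hA,
            Finset.disjoint_of_subset_left hB Finset.disjoint_sdiff⟩
        · rw [Finset.card_union_of_disjoint hAB]
          omega
      have key' : ∀ P ∈ S₁.powersetCard 2,
          𝔼 ω, (∏ a ∈ A, ind X ω a) * (∏ a ∈ P, ind X ω a) * ψ ω =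
            p ^ A.card * p ^ 2 * (1 - e * p + (e : ℝ) * (e - 1) / 2 * p ^ 2) ^ l := by
        intro P hP
        obtain ⟨hP₁, hP₂⟩ := Finset.mem_powersetCard.1 hP
        rw [key P hP₁ hP₂.le, hP₂]
      have hexp : ∀ ω, (∏ a ∈ A, ind X ω a) * ((1 - ∑ a ∈ S₁, ind X ω a +
          ∑ P ∈ S₁.powersetCard 2, ∏ a ∈ P, ind X ω a) * ψ ω) =
          (∏ a ∈ A, ind X ω a) * (∏ a ∈ (∅ : Finset (Fin n)), ind X ω a) * ψ ω -
          ∑ u ∈ S₁, (∏ a ∈ A, ind X ω a) * (∏ a ∈ {u}, ind X ω a) * ψ ω +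
          ∑ P ∈ S₁.powersetCard 2, (∏ a ∈ A, ind X ω a) * (∏ a ∈ P, ind X ω a) * ψ ω := by
        intro ω
        simp_rw [Finset.prod_singleton, Finset.prod_empty]
        rw [← Finset.sum_mul, ← Finset.sum_mul, ← Finset.mul_sum, ← Finset.mul_sum]
        ring
      rw [Finset.expect_congr rfl fun ω _ => hexp ω, Finset.expect_add_distrib,
        Finset.expect_sub_distrib, Finset.expect_sum_comm, Finset.expect_sum_comm,
        key ∅ (by simp) (by simp),
        Finset.sum_congr rfl fun u hu => key {u} (by simpa using hu) (by simp),
        Finset.sum_congr rfl fun P hP => key' P hP]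
      simp [hcard, Nat.cast_choose_two]
      ring

/-- Expanding `2^|T ∩ X|` over the subsets `A` of `T` reduces this to the exact expectations of
`KWise.exists_dominating`; summing `p^|A|` gives `(1 + p)^|T|`. -/
theorem KWise.expect_avoid_le (h : KWise k p X) {l : ℕ} {S T : Finset (Fin n)}
    (hST : Disjoint T S) (hS : l * e ≤ S.card) (hk : T.card + 2 * l ≤ k) :
    𝔼 ω, (if Disjoint S (X ω) then (2 : ℝ) ^ (T ∩ X ω).card else 0) ≤
      (1 + p) ^ T.card * (1 - e * p + (e : ℝ) * (e - 1) / 2 * p ^ 2) ^ l := by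
  obtain ⟨ψ, h₁, h₂, h₃⟩ := h.exists_dominating e l S hS
  calc _ ≤ 𝔼 ω, (∏ a ∈ T, (1 + ind X ω a)) * ψ ω := by
        refine Finset.expect_le_expect fun ω _ => ?_
        rw [prod_one_add_ind]
        split_ifs with hd
        · exact le_mul_of_one_le_right (by positivity) (h₂ ω hd)
        · exact mul_nonneg (by positivity) (h₁ ω)
    _ = ∑ A ∈ T.powerset, 𝔼 ω, (∏ a ∈ A, ind X ω a) * ψ ω := by
        simp_rw [Finset.prod_one_add, Finset.sum_mul]
        rw [Finset.expect_sum_comm]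
    _ = ∑ A ∈ T.powerset, p ^ A.card * (1 - e * p + (e : ℝ) * (e - 1) / 2 * p ^ 2) ^ l := by
        refine Finset.sum_congr rfl fun A hA => ?_
        have hAT := Finset.mem_powerset.1 hA
        exact h₃ A (Finset.disjoint_of_subset_left hAT hST)
          ((Nat.add_le_add_right (Finset.card_le_card hAT) _).trans hk)
    _ = _ := by
        rw [← Finset.sum_mul]
        congr 1
        have := Finset.prod_one_add (f := fun _ : Fin n => p) T
        simp only [Finset.prod_const] at this
        exact this.symm

/-- Sets of size less than `n / (2 * e)` are replaced by the full set. -/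
def enlarge {n : ℕ} (e : ℕ) (S : Finset (Fin n)) : Finset (Fin n) :=
  if 2 * e * S.card < n then univ else S

theorem le_card_enlarge (e : ℕ) (S : Finset (Fin n)) (he : 1 ≤ e) :
    n ≤ 2 * e * (enlarge e S).card := by
  unfold enlarge
  split_ifs with h
  · rw [Finset.card_univ, Fintype.card_fin]
    exact Nat.le_mul_of_pos_left _ (by omega)
  · omega

/-- A random set is likely to be disjoint from `T` and to meet `U`. -/
theorem KWise.good_expect_ge (h : KWise k p X) [Nonempty Ω] (hk : 2 ≤ k) (he : 1 ≤ e)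
    (hp₁ : 3 / 5 ≤ p * e) (hp₂ : p * e ≤ 61 / 100) (hn : 100000 * e ≤ n)
    {T U : Finset (Fin n)} (hT : T.card ≤ e) (hU : U.card = e) (hUT : Disjoint U T) :
    1 / 40 ≤ 𝔼 ω, (if Disjoint T (enlarge e (X ω)) ∧ ¬ Disjoint U (enlarge e (X ω))
      then (1 : ℝ) else 0) := by
  have he' : (1 : ℝ) ≤ e := by exact_mod_cast he
  have hn' : (100000 : ℝ) * e ≤ n := by exact_mod_cast hn
  have hT' : (T.card : ℝ) ≤ e := by exact_mod_cast hT
  have hp : 0 ≤ p := by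
    by_contra hlt
    nlinarith
  set s : ℝ := n / (10 * e) with hs
  have hn0 : (0 : ℝ) < n := by linarith
  have hs0 : 0 < s := by positivity
  have hse : s * (10 * e) = n := by rw [hs]; field_simp
  -- With `u` and `v` the hits in `U` and `T`, Bonferroni bounds the indicator of `v = 0`, `u ≠ 0`
  -- below by `u - uv - u(u-1)/2`. The last term is `(|X| - np)^2 / s^2`, which pays for rows that
  -- are enlarged. All terms have degree at most two, so pairwise independence suffices.
  have hpt : ∀ ω, (∑ a ∈ U, ind X ω a) - (∑ a ∈ U, ind X ω a) * (∑ b ∈ T, ind X ω b) -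
      (∑ P ∈ U.powersetCard 2, ∏ a ∈ P, ind X ω a) -
      (s ^ 2)⁻¹ * ((∑ a ∈ univ, ind X ω a) * (1 - 2 * (n * p)) +
        2 * (∑ P ∈ (univ : Finset (Fin n)).powersetCard 2, ∏ a ∈ P, ind X ω a) + (n * p) ^ 2) ≤
      (if Disjoint T (enlarge e (X ω)) ∧ ¬ Disjoint U (enlarge e (X ω)) then (1 : ℝ) else 0) := by
    intro ω
    simp_rw [sum_ind, sum_pairs, Nat.cast_choose_two, Finset.univ_inter]
    have hsq : ((X ω).card : ℝ) * (1 - 2 * (n * p)) +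
        2 * (((X ω).card : ℝ) * ((X ω).card - 1) / 2) + (n * p) ^ 2 =
        ((X ω).card - n * p) ^ 2 := by ring
    rw [hsq]
    set u := (U ∩ X ω).card with hu
    set v := (T ∩ X ω).card with hv
    have hmain : (u : ℝ) - u * v - u * (u - 1) / 2 ≤
        if v = 0 ∧ u ≠ 0 then (1 : ℝ) else 0 := by
      split_ifs with hc
      · obtain ⟨hv0, hu0⟩ := hc
        rw [hv0]
        rcases Nat.lt_or_ge u 3 with hlt | hge
        · interval_cases u <;> norm_num
        · have : (3 : ℝ) ≤ u := by exact_mod_cast hge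
          push_cast
          nlinarith
      · rcases Nat.eq_zero_or_pos u with h0 | h0
        · simp [h0]
        · have hv0 : 1 ≤ v := by
            rcases Nat.eq_zero_or_pos v with h1 | h1
            · exact absurd ⟨h1, h0.ne'⟩ hc
            · exact h1
          have h1 : (1 : ℝ) ≤ u := by exact_mod_cast h0
          have h2 : (1 : ℝ) ≤ v := by exact_mod_cast hv0
          nlinarith
    have hnn : 0 ≤ (s ^ 2)⁻¹ * (((X ω).card : ℝ) - n * p) ^ 2 := by positivity
    by_cases hlow : 2 * e * (X ω).card < n
    · have hlow' : 2 * (e : ℝ) * (X ω).card < n := by exact_mod_cast hlow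
      -- The mean is at least `3n/(5e)` and enlarged rows have weight below `n/(2e)`; the gap is `s
      -- = n/(10e)`.
      have hdev : s ≤ n * p - (X ω).card := by
        have : s * (10 * e) ≤ (n * p - (X ω).card) * (10 * e) := by nlinarith
        exact le_of_mul_le_mul_right this (by positivity)
      have : 1 ≤ (s ^ 2)⁻¹ * (((X ω).card : ℝ) - n * p) ^ 2 := by
        rw [inv_mul_eq_div, one_le_div (by positivity)]
        nlinarith
      have hle1 : (u : ℝ) - u * v - u * (u - 1) / 2 ≤ 1 := hmain.trans (by split_ifs <;> norm_num)
      have : (0 : ℝ) ≤ if Disjoint T (enlarge e (X ω)) ∧ ¬ Disjoint U (enlarge e (X ω))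
        then (1 : ℝ) else 0 := by split_ifs <;> norm_num
      linarith
    · have hiff : (v = 0 ∧ u ≠ 0) ↔ (Disjoint T (X ω) ∧ ¬ Disjoint U (X ω)) := by
        rw [hu, hv, Ne, Finset.card_eq_zero, Finset.card_eq_zero,
          Finset.disjoint_iff_inter_eq_empty, Finset.disjoint_iff_inter_eq_empty]
      rw [enlarge, if_neg hlow]
      simp only [hiff] at hmain
      linarith
  refine le_trans ?_ (Finset.expect_le_expect fun ω _ => hpt ω)
  rw [Finset.expect_sub_distrib, Finset.expect_sub_distrib, Finset.expect_sub_distrib,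
    ← Finset.mul_expect, Finset.expect_add_distrib, Finset.expect_add_distrib,
    ← Finset.expect_mul, ← Finset.mul_expect, h.expect_sum (by omega), h.expect_cross hk hUT,
    h.expect_pairs hk, h.expect_sum (by omega), h.expect_pairs hk, Finset.expect_const
      Finset.univ_nonempty, hU, Finset.card_univ, Fintype.card_fin]
  have hvar : (n : ℝ) * p * (1 - 2 * (n * p)) + 2 * ((n : ℝ) * (n - 1) / 2 * p ^ 2) +
      (n * p) ^ 2 ≤ n * p := by nlinarith [mul_nonneg (Nat.cast_nonneg (α := ℝ) n) (sq_nonneg p)]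
  have hcheb : (s ^ 2)⁻¹ * ((n : ℝ) * p * (1 - 2 * (n * p)) +
      2 * ((n : ℝ) * (n - 1) / 2 * p ^ 2) + (n * p) ^ 2) ≤ 1 / 100 := by
    rw [inv_mul_eq_div, div_le_iff₀ (by positivity)]
    refine hvar.trans ?_
    have h1 : (10000 : ℝ) ≤ s := by nlinarith
    have h2 : (n : ℝ) * p ≤ 61 / 10 * s := by
      rw [← hse]
      nlinarith
    nlinarith
  have h3 : (e : ℝ) * T.card * p ^ 2 ≤ (p * e) ^ 2 := by
    have : (e : ℝ) * T.card * p ^ 2 ≤ e * e * p ^ 2 := by gcongr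
    nlinarith
  have h4 : (e : ℝ) * (e - 1) / 2 * p ^ 2 ≤ (p * e) ^ 2 / 2 := by
    nlinarith [mul_nonneg (Nat.cast_nonneg (α := ℝ) e) (sq_nonneg p)]
  nlinarith

/-- A random set is unlikely to be contained in a small member of a family. -/
theorem KWise.bad_expect_le (h : KWise k p X) [Nonempty Ω] {L : ℕ} (he : 1 ≤ e) (hL : 1 ≤ L)
    (hp₁ : 3 / 5 ≤ p * e) (hp₂ : p * e ≤ 61 / 100)
    (hk : e + 2 * ⌈40 * Real.log (L + 1)⌉₊ ≤ k) {T : Finset (Fin n)} (hT : T.card ≤ e)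
    {𝒱 : Finset (Finset (Fin n))} (h𝒱 : 𝒱.card ≤ L)
    (hV : ∀ V ∈ 𝒱, V.card + e + ⌈40 * Real.log (L + 1)⌉₊ * e ≤ n) :
    𝔼 ω, (if ∃ V ∈ 𝒱, enlarge e (X ω) ⊆ V then (2 : ℝ) ^ (T ∩ enlarge e (X ω)).card else 1) ≤
      1 + 1 / 24000 := by
  classical
  set l := ⌈40 * Real.log (L + 1)⌉₊ with hl
  have he' : (1 : ℝ) ≤ e := by exact_mod_cast he
  have hL' : (1 : ℝ) ≤ L := by exact_mod_cast hL
  have hp : 0 ≤ p := by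
    by_contra hlt
    nlinarith
  -- A full row lies in no `V`, since `|V| + e ≤ n` and `e ≥ 1`. Any other row inside `V` avoids
  -- `Vᶜ`, and removing `T` makes the avoided set disjoint from the weight's support.
  have hpt : ∀ ω, (if ∃ V ∈ 𝒱, enlarge e (X ω) ⊆ V
      then (2 : ℝ) ^ (T ∩ enlarge e (X ω)).card else 1) ≤
      1 + ∑ V ∈ 𝒱, (if Disjoint (Vᶜ \ T) (X ω) then (2 : ℝ) ^ (T ∩ X ω).card else 0) := by
    intro ω
    have hnn : ∀ V ∈ 𝒱, (0 : ℝ) ≤ if Disjoint (Vᶜ \ T) (X ω) then (2 : ℝ) ^ (T ∩ X ω).card else 0 :=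
      fun V _ => by split_ifs <;> positivity
    split_ifs with hc
    · obtain ⟨V, hV', hsub⟩ := hc
      have hlow : ¬ 2 * e * (X ω).card < n := by
        intro hlow
        rw [enlarge, if_pos hlow] at hsub
        have := Finset.card_le_card hsub
        rw [Finset.card_univ, Fintype.card_fin] at this
        have := hV V hV'
        omega
      rw [enlarge, if_neg hlow] at hsub ⊢
      have hd : Disjoint (Vᶜ \ T) (X ω) := by
        rw [Finset.disjoint_left]
        intro a ha ha'
        exact Finset.mem_compl.1 (Finset.mem_sdiff.1 ha).1 (hsub ha')
      have := Finset.single_le_sum hnn hV'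
      rw [if_pos hd] at this
      linarith
    · have := Finset.sum_nonneg hnn
      linarith
  refine (Finset.expect_le_expect fun ω _ => hpt ω).trans ?_
  rw [Finset.expect_add_distrib, Finset.expect_const Finset.univ_nonempty, Finset.expect_sum_comm]
  -- The left side is at most `1 - x + x²/2` with `x = p * e` between `0.6` and `0.61`, hence below
  -- `0.59`. So `l ≥ 40 log(L+1)` blocks contribute at most `(L+1)^(-20)`.
  have hγ : 1 - e * p + (e : ℝ) * (e - 1) / 2 * p ^ 2 ≤ Real.exp (-1 / 2) := by
    have h1 : (e : ℝ) * (e - 1) / 2 * p ^ 2 ≤ (p * e) ^ 2 / 2 := by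
      nlinarith [mul_nonneg (Nat.cast_nonneg (α := ℝ) e) (sq_nonneg p)]
    have h2 : Real.exp (1 / 2) ≤ 169 / 100 := by
      have h3 : Real.exp (1 / 2) ^ 2 = Real.exp 1 := by
        rw [← Real.exp_nat_mul]
        norm_num
      have := Real.exp_one_lt_d9
      nlinarith [Real.exp_pos (1 / 2)]
    have h3 : Real.exp (-1 / 2) = (Real.exp (1 / 2))⁻¹ := by
      rw [← Real.exp_neg]
      norm_num
    have h4 : (59 / 100 : ℝ) ≤ Real.exp (-1 / 2) := by
      rw [h3, le_inv_comm₀ (by norm_num) (Real.exp_pos _)]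
      refine h2.trans (by norm_num)
    nlinarith
  have hγ0 : 0 ≤ 1 - e * p + (e : ℝ) * (e - 1) / 2 * p ^ 2 := by
    have : 0 ≤ (e : ℝ) * (e - 1) / 2 * p ^ 2 :=
      mul_nonneg (div_nonneg (mul_nonneg (by linarith) (by linarith)) (by norm_num)) (sq_nonneg p)
    nlinarith
  have hterm : ∀ V ∈ 𝒱,
      𝔼 ω, (if Disjoint (Vᶜ \ T) (X ω) then (2 : ℝ) ^ (T ∩ X ω).card else 0) ≤
      2 * ((L + 1 : ℝ) ^ 20)⁻¹ := by
    intro V hV'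
    have hcard : l * e ≤ (Vᶜ \ T).card := by
      have h1 := Finset.le_card_sdiff T Vᶜ
      rw [Finset.card_compl, Fintype.card_fin] at h1
      have := hV V hV'
      omega
    refine (h.expect_avoid_le (e := e) (l := l) Finset.disjoint_sdiff hcard (by omega)).trans ?_
    refine mul_le_mul ?_ ?_ (by positivity) (by norm_num)
    · calc (1 + p) ^ T.card ≤ (1 + p) ^ e := pow_le_pow_right₀ (by linarith) hT
        _ ≤ Real.exp p ^ e := by
            gcongr
            have := Real.add_one_le_exp p
            linarith
        _ = Real.exp (e * p) := by rw [← Real.exp_nat_mul]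
        _ ≤ Real.exp (Real.log 2) := by
            have := Real.log_two_gt_d9
            rw [Real.exp_le_exp]
            linarith
        _ = 2 := Real.exp_log (by norm_num)
    · calc _ ≤ Real.exp (-1 / 2) ^ l := by gcongr
        _ = Real.exp (l * (-1 / 2)) := by rw [← Real.exp_nat_mul]
        _ ≤ Real.exp (-(20 * Real.log (L + 1))) := by
            rw [Real.exp_le_exp]
            have := Nat.le_ceil (40 * Real.log ((L : ℝ) + 1))
            linarith
        _ = _ := by
            rw [Real.exp_neg, ← Real.exp_log (x := (L : ℝ) + 1) (by positivity),
              ← Real.exp_nat_mul, Real.log_exp]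
            norm_num
  have hsum := Finset.sum_le_sum hterm
  refine (add_le_add_right hsum 1).trans ?_
  rw [Finset.sum_const, nsmul_eq_mul]
  have h𝒱' : (𝒱.card : ℝ) ≤ L + 1 := by
    have : (𝒱.card : ℝ) ≤ L := by exact_mod_cast h𝒱
    linarith
  have hfin : (𝒱.card : ℝ) * (2 * ((L + 1 : ℝ) ^ 20)⁻¹) ≤ 1 / 24000 := by
    calc _ ≤ (L + 1 : ℝ) * (2 * ((L + 1 : ℝ) ^ 20)⁻¹) := by gcongr
      _ = 2 * ((L + 1 : ℝ) ^ 19)⁻¹ := by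
          field_simp
      _ ≤ 2 * ((2 : ℝ) ^ 19)⁻¹ := by
          gcongr
          linarith
      _ ≤ _ := by norm_num
  linarith

end RandomSubset

/-! ### Polynomial hashing -/

section Hashing

open Finset
open scoped BigOperators

/-- All fibres of a surjective homomorphism are cosets of the kernel, so it carries the uniform
distribution to the uniform distribution. -/
theorem sum_comp_of_surjective {G H : Type} [AddGroup G] [AddGroup H] [Fintype G] [Fintype H]
    [DecidableEq H] (Φ : G →+ H) (hΦ : Function.Surjective Φ) (φ : H → ℝ) :
    𝔼 g, φ (Φ g) = 𝔼 h, φ h := by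
  have hfib : ∀ h : H, #{g | Φ g = h} = #{g | Φ g = 0} := fun h =>
    AddMonoidHom.card_fiber_eq_of_mem_range Φ (hΦ h) ⟨0, map_zero Φ⟩
  have hsum : ∀ ψ : H → ℝ, ∑ g, ψ (Φ g) = #{g | Φ g = 0} * ∑ h, ψ h := by
    intro ψ
    rw [Finset.mul_sum, ← Finset.sum_fiberwise univ Φ]
    refine Finset.sum_congr rfl fun h _ => ?_
    rw [← hfib h, Finset.sum_congr rfl (g := fun _ => ψ h) fun g hg => by
      rw [(Finset.mem_filter.1 hg).2]]
    simp
  have hcard : (Fintype.card G : ℝ) = #{g | Φ g = 0} * Fintype.card H := by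
    simpa using hsum fun _ => 1
  have hpos : (Fintype.card G : ℝ) ≠ 0 := by simp
  rw [Fintype.expect_eq_sum_div_card, Fintype.expect_eq_sum_div_card, hsum, hcard]
  rw [hcard] at hpos
  exact mul_div_mul_left _ _ (left_ne_zero_of_mul hpos)

variable {q : ℕ} [Fact q.Prime] {n k e : ℕ}

/-- The value at `j` of the polynomial with coefficients `c`, the leading one first. -/
def polyHash (c : Fin k → ZMod q) (j : ZMod q) : ZMod q := ∑ s : Fin k, c s * j ^ (k - 1 - s.val)

/-- The elements whose hash value is below `3 * q / (5 * e)`. -/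
def polyRow (n e : ℕ) (c : Fin k → ZMod q) : Finset (Fin n) :=
  univ.filter fun j => 5 * e * (polyHash c (j.val : ZMod q)).val < 3 * q

/-- The evaluation of polynomials at the points of `A`. -/
def evalHom (k q : ℕ) [Fact q.Prime] (A : Finset (Fin n)) : (Fin k → ZMod q) →+ (A → ZMod q) where
  toFun c a := polyHash c (a.val.val : ZMod q)
  map_zero' := by
    ext a
    simp [polyHash]
  map_add' c d := by
    ext a
    simp [polyHash, add_mul, Finset.sum_add_distrib]

/-- Lagrange interpolation; the nodes are distinct mod `q` because `n ≤ q`. -/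
theorem evalHom_surjective (hk : 0 < k) (hn : n ≤ q) {A : Finset (Fin n)} (hA : A.card ≤ k) :
    Function.Surjective (evalHom k q A) := by
  classical
  intro r
  let v : Fin n → ZMod q := fun j => (j.val : ZMod q)
  let r' : Fin n → ZMod q := fun j => if h : j ∈ A then r ⟨j, h⟩ else 0
  have hv : Set.InjOn v A := by
    intro a _ b _ hab
    have := congrArg ZMod.val hab
    simp only [v] at this
    rw [ZMod.val_natCast_of_lt (a.isLt.trans_le hn), ZMod.val_natCast_of_lt (b.isLt.trans_le hn)]
      at this
    exact Fin.ext this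
  let P := Lagrange.interpolate A v r'
  have hdeg : P.natDegree < k := by
    by_cases hP : P = 0
    · simpa [hP] using hk
    · rw [Polynomial.natDegree_lt_iff_degree_lt hP]
      exact (Lagrange.degree_interpolate_lt r' hv).trans_le (by exact_mod_cast hA)
  refine ⟨fun s => P.coeff (k - 1 - s), ?_⟩
  ext a
  have h1 := Lagrange.eval_interpolate_at_node r' hv a.2
  have h2 := Polynomial.eval_eq_sum_range' hdeg (v a.val)
  have h3 : r' a.val = r a := by simp [r']
  change ∑ s : Fin k, P.coeff (k - 1 - s) * v a.val ^ (k - 1 - s.val) = r a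
  rw [← h3, ← h1, h2, ← Finset.sum_range_reflect, Finset.sum_range]

/-- The probability that an element is in `polyRow n e c`. -/
noncomputable def density (q e : ℕ) : ℝ := (((3 * q + 5 * e - 1) / (5 * e) : ℕ) : ℝ) / q

/-- The right side is the ceiling of `3q/(5e)`. Rounding up makes `density q e * e` at least `3/5`,
and it exceeds `3/5` by at most `e/q`. -/
theorem card_small_residues (he : 1 ≤ e) :
    #{r : ZMod q | 5 * e * r.val < 3 * q} = (3 * q + 5 * e - 1) / (5 * e) := by
  have hq : 0 < q := (Fact.out : q.Prime).pos
  have key : ∀ r, 5 * e * r < 3 * q ↔ r < (3 * q + 5 * e - 1) / (5 * e) := by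
    intro r
    rw [Nat.lt_iff_add_one_le (m := r), Nat.le_div_iff_mul_le (by omega), Nat.add_one_mul r, mul_comm r]
    omega
  rw [← Finset.card_range ((3 * q + 5 * e - 1) / (5 * e))]
  refine Finset.card_nbij ZMod.val ?_ ?_ ?_
  · intro r hr
    simpa [key] using hr
  · exact (ZMod.val_injective q).injOn
  · intro r hr
    have hr' : 5 * e * r < 3 * q := by simpa [key] using hr
    have hrq : r < q := by
      by_contra hge
      have : 5 * 1 * q ≤ 5 * e * r := Nat.mul_le_mul (by omega) (by omega)
      omega
    refine ⟨(r : ZMod q), ?_, ZMod.val_natCast_of_lt hrq⟩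
    simpa [ZMod.val_natCast_of_lt hrq] using hr'

theorem le_density_mul (hq : 0 < q) (he : 1 ≤ e) : 3 / 5 ≤ density q e * e := by
  have hq' : (0 : ℝ) < q := by exact_mod_cast hq
  have h : 3 * q ≤ 5 * e * ((3 * q + 5 * e - 1) / (5 * e)) := by
    have := Nat.lt_mul_div_succ (3 * q + 5 * e - 1) (show 0 < 5 * e by omega)
    rw [Nat.mul_add] at this
    omega
  have h' : 3 * (q : ℝ) ≤ 5 * e * (((3 * q + 5 * e - 1) / (5 * e) : ℕ) : ℝ) := by exact_mod_cast h
  rw [density, div_mul_eq_mul_div, le_div_iff₀ hq']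
  linarith

theorem density_mul_le (hq : 100 * e ≤ q) (he : 1 ≤ e) : density q e * e ≤ 61 / 100 := by
  have hq' : (0 : ℝ) < q := by
    have : 0 < q := by omega
    exact_mod_cast this
  have h : 5 * e * ((3 * q + 5 * e - 1) / (5 * e)) ≤ 3 * q + 5 * e := by
    have := Nat.mul_div_le (3 * q + 5 * e - 1) (5 * e)
    omega
  have h' : 5 * (e : ℝ) * (((3 * q + 5 * e - 1) / (5 * e) : ℕ) : ℝ) ≤ 3 * q + 5 * e := by
    exact_mod_cast h
  have hq2 : 100 * (e : ℝ) ≤ q := by exact_mod_cast hq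
  rw [density, div_mul_eq_mul_div, div_le_iff₀ hq']
  linarith

/-- The values of the polynomial on at most `k` points are uniform on `A → ZMod q`, so the
expectation of the product of indicators factors. -/
theorem kWise_polyRow (hk : 0 < k) (hn : n ≤ q) (he : 1 ≤ e) :
    KWise k (density q e) (polyRow (q := q) (k := k) n e) := by
  classical
  intro A hA
  let φ : (A → ZMod q) → ℝ := fun h => ∏ a, if 5 * e * (h a).val < 3 * q then (1 : ℝ) else 0
  have h1 : ∀ c : Fin k → ZMod q, ∏ a ∈ A, ind (polyRow n e) c a = φ (evalHom k q A c) := by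
    intro c
    rw [← Finset.prod_coe_sort]
    refine Finset.prod_congr rfl fun a _ => ?_
    refine if_congr ?_ rfl rfl
    simp [polyRow, evalHom]
  rw [Finset.expect_congr rfl fun c _ => h1 c]
  refine (sum_comp_of_surjective (evalHom k q A) (evalHom_surjective hk hn hA) φ).trans ?_
  rw [Fintype.expect_eq_sum_div_card, ← Fintype.piFinset_univ,
    ← Finset.prod_univ_sum (fun _ : A => (univ : Finset (ZMod q)))
      fun _ r => if 5 * e * r.val < 3 * q then (1 : ℝ) else 0]
  simp [Finset.sum_boole, card_small_residues he, density, div_pow, ZMod.card]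

end Hashing

/-! ### The coefficients read from the random bits -/

section Blocks

open Finset
open scoped BigOperators

variable {R : ℕ} {q : ℕ} [Fact q.Prime] {t k m : ℕ}

theorem readBit_eq_of_blockVal_eq {x y : Fin R → Bool} {pos : ℕ} (m : ℕ)
    (h : blockVal x pos m = blockVal y pos m) : ∀ u < m, readBit x (pos + u) = readBit y (pos + u) := by
  induction m with
  | zero => intro u hu; omega
  | succ m ih =>
    have h1 := readBit_le_one x (pos + m)
    have h2 := readBit_le_one y (pos + m)
    rw [blockVal, blockVal] at h
    intro u hu
    rcases Nat.lt_succ_iff_lt_or_eq.1 hu with hlt | rfl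
    · exact ih (by omega) u hlt
    · omega

theorem eq_of_readBit_eq {x y : Fin R → Bool} {p : ℕ} (hp : p < R)
    (h : readBit x p = readBit y p) : x ⟨p, hp⟩ = y ⟨p, hp⟩ := by
  simp only [readBit, dif_pos hp] at h
  revert h
  cases x ⟨p, hp⟩ <;> cases y ⟨p, hp⟩ <;> simp

/-- The coefficients of the hash functions of the rows. -/
def coefs (q t k m : ℕ) (x : Fin R → Bool) (i : Fin t) (s : Fin k) : ZMod q :=
  (blockVal x ((i.val * k + s.val) * m) m : ZMod q)

theorem card_residue_class_le (r : ZMod q) (N : ℕ) :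
    (#{v ∈ range N | ((v : ℕ) : ZMod q) = r} : ℝ) ≤ N / q + 1 := by
  have hq : 0 < q := (Fact.out : q.Prime).pos
  have h1 : #{v ∈ range N | ((v : ℕ) : ZMod q) = r} = Nat.count (fun v => v ≡ r.val [MOD q]) N := by
    rw [Nat.count_eq_card_filter_range]
    congr 1
    refine Finset.filter_congr fun v _ => ?_
    rw [← ZMod.natCast_eq_natCast_iff, ZMod.natCast_zmod_val]
  rw [h1, Nat.count_modEq_card _ hq]
  have h2 : ((N / q : ℕ) : ℝ) ≤ N / q := Nat.cast_div_le
  push_cast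
  split_ifs <;> norm_num <;> linarith

/-- The `t * k` block values together with the unused trailing bits determine `x`, and each block
has at most `2^m/q + 1` values in a given residue class. -/
theorem card_coefs_fiber_le (h : t * k * m ≤ R) (c : Fin t → Fin k → ZMod q) :
    (#{x : Fin R → Bool | coefs q t k m x = c} : ℝ) ≤
      (2 ^ m / q + 1 : ℝ) ^ (t * k) * 2 ^ (R - t * k * m) := by
  classical
  let D : Finset ((Fin t → Fin k → ℕ) × (Fin (R - t * k * m) → Bool)) :=
    (Fintype.piFinset fun i => Fintype.piFinset fun s =>
      {v ∈ range (2 ^ m) | ((v : ℕ) : ZMod q) = c i s}) ×ˢ univ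
  have hD : #{x : Fin R → Bool | coefs q t k m x = c} ≤ #D := by
    refine Finset.card_le_card_of_injOn (fun x =>
      (fun i s => blockVal x ((i.val * k + s.val) * m) m,
        fun r => x ⟨t * k * m + r.val, by omega⟩)) ?_ ?_
    · intro x hx
      have hx' : coefs q t k m x = c := by simpa using hx
      simp only [D, Finset.coe_product, Set.mem_prod, Finset.mem_coe, Fintype.mem_piFinset,
        Finset.mem_filter, Finset.mem_range, Finset.mem_univ, and_true]
      exact fun i s => ⟨blockVal_lt _ _ _, congrFun (congrFun hx' i) s⟩
    · intro x _ y _ hxy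
      obtain ⟨h1, h2⟩ := Prod.mk.inj hxy
      funext p
      rcases Nat.lt_or_ge p.val (t * k * m) with hp | hp
      · have hm : 0 < m := Nat.pos_of_ne_zero fun h0 => by simp [h0] at hp
        have hb : p.val / m < t * k := Nat.div_lt_of_lt_mul (by rwa [mul_comm])
        have hk : 0 < k := Nat.pos_of_ne_zero fun h0 => by simp [h0] at hb
        have hi : p.val / m / k < t := Nat.div_lt_of_lt_mul (by rwa [mul_comm])
        have hs : p.val / m % k < k := Nat.mod_lt _ hk
        have e1 := readBit_eq_of_blockVal_eq m
          (congrFun (congrFun h1 ⟨_, hi⟩) ⟨_, hs⟩) (p.val % m) (Nat.mod_lt _ hm)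
        have e2 : (p.val / m / k * k + p.val / m % k) * m + p.val % m = p.val := by
          rw [Nat.div_add_mod', Nat.div_add_mod']
        simp only [e2] at e1
        exact eq_of_readBit_eq p.isLt e1
      · have := congrFun h2 ⟨p.val - t * k * m, by omega⟩
        simpa [Nat.add_sub_cancel' hp] using this
  have hcard : (#D : ℝ) ≤ (2 ^ m / q + 1 : ℝ) ^ (t * k) * 2 ^ (R - t * k * m) := by
    simp only [D, Finset.card_product, Fintype.card_piFinset, Finset.card_univ, Fintype.card_fun,
      Fintype.card_bool, Fintype.card_fin]
    push_cast
    gcongr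
    calc _ ≤ ∏ _i : Fin t, ∏ _s : Fin k, (2 ^ m / q + 1 : ℝ) := by
          refine Finset.prod_le_prod (fun _ _ => by positivity) fun i _ =>
            Finset.prod_le_prod (fun _ _ => by positivity) fun s _ => ?_
          simpa using card_residue_class_le (c i s) (2 ^ m)
      _ = _ := by
          simp [← pow_mul, mul_comm]
  exact le_trans (by exact_mod_cast hD) hcard

/-- Under random bits the probability of an event is at most twice as large as under uniformly
random coefficients. -/
theorem bitProb_coefs_le (h : t * k * m ≤ R) (hm : 2 * q * (t * k) ≤ 2 ^ m)
    (E : Set (Fin t → Fin k → ZMod q)) :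
    bitProb (fun x : Fin R → Bool => coefs q t k m x ∈ E) ≤
      2 * (E.ncard / (Fintype.card (Fin k → ZMod q) : ℝ) ^ t) := by
  classical
  have hq : (0 : ℝ) < q := by exact_mod_cast (Fact.out : q.Prime).pos
  have h1 : (Set.ncard {x : Fin R → Bool | coefs q t k m x ∈ E} : ℝ) ≤
      E.ncard * ((2 ^ m / q + 1 : ℝ) ^ (t * k) * 2 ^ (R - t * k * m)) := by
    have e1 : Set.ncard {x : Fin R → Bool | coefs q t k m x ∈ E} =
        #{x : Fin R → Bool | coefs q t k m x ∈ E.toFinset} := by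
      rw [← Set.ncard_coe_finset]
      simp
    rw [e1, Finset.card_eq_sum_card_fiberwise (f := coefs q t k m) (t := E.toFinset)
      (fun x hx => by simpa using hx), Set.ncard_eq_toFinset_card']
    push_cast
    rw [← nsmul_eq_mul, ← Finset.sum_const]
    refine Finset.sum_le_sum fun c _ => le_trans ?_ (card_coefs_fiber_le h c)
    exact_mod_cast Finset.card_le_card fun x hx => by
      simp only [Finset.mem_filter, Finset.mem_univ, true_and] at hx ⊢
      exact hx.2
  -- The bias over all coefficients is `(1 + q/2^m)^(tk)`, at most `exp(1/2) ≤ 2` by the choice of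
  -- `m`.
  have h2 : (2 ^ m / q + 1 : ℝ) ^ (t * k) * 2 ^ (R - t * k * m) ≤
      2 * 2 ^ R / (q : ℝ) ^ (t * k) := by
    have h3 : (2 ^ m / q + 1 : ℝ) = 2 ^ m / q * (1 + q / 2 ^ m) := by
      field_simp
    have h4 : (1 + q / 2 ^ m : ℝ) ^ (t * k) ≤ 2 := by
      calc (1 + q / 2 ^ m : ℝ) ^ (t * k) ≤ Real.exp (q / 2 ^ m) ^ (t * k) := by
            gcongr
            have := Real.add_one_le_exp ((q : ℝ) / 2 ^ m)
            linarith
        _ = Real.exp ((t * k : ℕ) * (q / 2 ^ m)) := by rw [← Real.exp_nat_mul]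
        _ ≤ Real.exp (Real.log 2) := by
            rw [Real.exp_le_exp]
            have : ((t * k : ℕ) : ℝ) * (q / 2 ^ m) ≤ 1 / 2 := by
              rw [mul_div_assoc', div_le_iff₀ (by positivity)]
              have : (2 * q * (t * k) : ℝ) ≤ 2 ^ m := by exact_mod_cast hm
              push_cast
              linarith
            have := Real.log_two_gt_d9
            linarith
        _ = 2 := Real.exp_log (by norm_num)
    have h5 : (2 : ℝ) ^ R = (2 ^ m) ^ (t * k) * 2 ^ (R - t * k * m) := by
      rw [← pow_mul, ← pow_add]
      congr 1
      rw [mul_comm m]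
      omega
    rw [h3, mul_pow, div_pow, h5]
    calc _ = (1 + q / 2 ^ m : ℝ) ^ (t * k) *
          ((2 ^ m) ^ (t * k) * 2 ^ (R - t * k * m) / (q : ℝ) ^ (t * k)) := by ring
      _ ≤ 2 * ((2 ^ m) ^ (t * k) * 2 ^ (R - t * k * m) / (q : ℝ) ^ (t * k)) := by gcongr
      _ = _ := by ring
  rw [bitProb, div_le_iff₀ (by positivity)]
  calc _ ≤ (E.ncard : ℝ) * (2 * 2 ^ R / (q : ℝ) ^ (t * k)) := h1.trans (by gcongr)
    _ = _ := by
      rw [Fintype.card_fun, Fintype.card_fin, ZMod.card]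
      push_cast
      rw [← pow_mul, mul_comm k t]
      ring

/-- Horner's rule: a further round multiplies all earlier coefficients by `j`, which is why the
exponents in `polyHash` run downwards. -/
theorem natCast_hashVal (x : Fin R → Bool) (base j k : ℕ) :
    (hashVal x base m q j k : ZMod q) =
      polyHash (fun s : Fin k => (blockVal x (base + s.val * m) m : ZMod q)) j := by
  induction k with
  | zero => simp [hashVal, polyHash]
  | succ k ih =>
    rw [hashVal, ZMod.natCast_mod]
    push_cast
    rw [ih, polyHash, polyHash, Fin.sum_univ_castSucc, Finset.sum_mul]
    congr 1
    · refine Finset.sum_congr rfl fun s _ => ?_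
      have : k + 1 - 1 - (Fin.castSucc s).val = k - 1 - s.val + 1 := by
        have := s.isLt
        simp
        omega
      rw [this, pow_succ]
      simp [mul_assoc]
    · simp

theorem hashVal_eq_val (x : Fin R → Bool) (i : Fin t) (j : ℕ) :
    hashVal x (i.val * k * m) m q j k = (polyHash (coefs q t k m x i) (j : ZMod q)).val := by
  have h := natCast_hashVal (q := q) (m := m) x (i.val * k * m) j k
  have hlt := hashVal_lt x (i.val * k * m) m j k (Fact.out : q.Prime).pos
  rw [← ZMod.val_natCast_of_lt hlt, h]
  congr 2
  funext s
  simp only [coefs]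
  congr 3
  ring

theorem card_hashRow (x : Fin R → Bool) (i : Fin t) (n e : ℕ) :
    (hashRow x (i.val * k * m) m q k e (Finset.range n)).card =
      (polyRow n e (coefs q t k m x i)).card := by
  rw [← Finset.card_map Fin.valEmbedding]
  congr 1
  ext j
  simp only [hashRow, polyRow, Finset.mem_filter, Finset.mem_range, Finset.mem_map,
    Finset.mem_univ, true_and, Fin.valEmbedding_apply, hashVal_eq_val]
  constructor
  · rintro ⟨h1, h2⟩
    exact ⟨⟨j, h1⟩, h2, rfl⟩
  · rintro ⟨a, h1, rfl⟩
    exact ⟨a.isLt, h1⟩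

theorem mem_enlarge_iff (x : Fin R → Bool) (i : Fin t) {n e : ℕ} (j : Fin n) :
    j ∈ enlarge e (polyRow n e (coefs q t k m x i)) ↔
      5 * e * hashVal x (i.val * k * m) m q j k < 3 * q ∨
        2 * e * (hashRow x (i.val * k * m) m q k e (Finset.range n)).card < n := by
  rw [card_hashRow, hashVal_eq_val, enlarge]
  split_ifs with h
  · simp [h]
  · rw [or_iff_left h]
    simp [polyRow]

end Blocks

/-! ### Random matrices with independent rows -/

section RandomMatrix

open Finset
open scoped BigOperators

variable {Ω : Type} [Fintype Ω] [Nonempty Ω] {n k e t L : ℕ} {p : ℝ} {X : Ω → Finset (Fin n)}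

/-- The matrix with given rows. -/
def ofRows (Y : Fin t → Finset (Fin n)) : Matrix (Fin t) (Fin n) Bool := fun i j => decide (j ∈ Y i)

theorem rowSet_ofRows (Y : Fin t → Finset (Fin n)) (i : Fin t) : rowSet (ofRows Y) i = Y i := by
  ext j
  simp [rowSet, ofRows]

theorem mem_isolatingRows_ofRows (Y : Fin t → Finset (Fin n)) (T : Finset (Fin n)) (a : Fin n)
    (i : Fin t) : i ∈ isolatingRows (ofRows Y) T a ↔ a ∈ Y i ∧ Disjoint T (Y i) := by
  simp [isolatingRows, ofRows, Finset.disjoint_left]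

theorem mem_badRows_ofRows (Y : Fin t → Finset (Fin n)) (𝒱 : Finset (Finset (Fin n))) (a : Fin n)
    (i : Fin t) : i ∈ badRows (ofRows Y) 𝒱 a ↔ a ∈ Y i ∧ ∃ V ∈ 𝒱, Y i ⊆ V := by
  simp [badRows, rowSet_ofRows]

/-- Markov's inequality for a product of independent factors. -/
theorem ncard_div_le_of_prod {φ : Ω → ℝ} (hφ : ∀ ω, 0 ≤ φ ω) {a b : ℝ} (ha : 0 < a)
    (hb : 𝔼 ω, φ ω ≤ b) {E : Set (Fin t → Ω)} (hE : ∀ c ∈ E, a ≤ ∏ i, φ (c i)) :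
    (E.ncard : ℝ) / (Fintype.card Ω : ℝ) ^ t ≤ b ^ t / a := by
  classical
  have hcard : (0 : ℝ) < Fintype.card Ω := by exact_mod_cast Fintype.card_pos
  have h0 : 0 ≤ ∑ ω, φ ω := Finset.sum_nonneg fun ω _ => hφ ω
  have h1 : E.ncard * a ≤ (∑ ω, φ ω) ^ t := by
    rw [Fintype.sum_pow, Set.ncard_eq_toFinset_card', ← nsmul_eq_mul]
    refine (Finset.card_nsmul_le_sum _ _ _ fun c hc => hE c (by simpa using hc)).trans ?_
    exact Finset.sum_le_sum_of_subset_of_nonneg (Finset.subset_univ _)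
      fun c _ _ => Finset.prod_nonneg fun i _ => hφ _
  rw [Fintype.expect_eq_sum_div_card, div_le_iff₀ hcard] at hb
  rw [div_le_div_iff₀ (by positivity) ha, ← mul_pow]
  exact h1.trans (by gcongr)

/-- Every row that misses `T` and meets `U` isolates some column of `U`. If each column is isolated
fewer than `b` times, there are at most `e * b ≤ t/100` such rows, far below the expected `t/40`.
The factor `1 - 1/2 · indicator` turns this into a lower-tail bound through Markov. -/
theorem ncard_few_isolating_le (h : KWise k p X) (hk : 2 ≤ k) (he : 1 ≤ e)
    (hp₁ : 3 / 5 ≤ p * e) (hp₂ : p * e ≤ 61 / 100) (hn : 100000 * e ≤ n)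
    {T U : Finset (Fin n)} (hT : T.card ≤ e) (hU : U.card = e) (hUT : Disjoint U T) {b : ℕ}
    (hb : 100 * (e * b) ≤ t) :
    (Set.ncard {c : Fin t → Ω | ∀ a ∈ U,
      (isolatingRows (ofRows fun i => enlarge e (X (c i))) T a).card < b} : ℝ) /
        (Fintype.card Ω : ℝ) ^ t ≤ Real.exp (-t / 100000) := by
  classical
  set φ : Ω → ℝ := fun ω => 1 - 1 / 2 *
    (if Disjoint T (enlarge e (X ω)) ∧ ¬ Disjoint U (enlarge e (X ω)) then (1 : ℝ) else 0) with hφ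
  have hmean : 𝔼 ω, φ ω ≤ 1 - 1 / 80 := by
    have := h.good_expect_ge hk he hp₁ hp₂ hn hT hU hUT
    rw [hφ, Finset.expect_sub_distrib, Finset.expect_const Finset.univ_nonempty,
      ← Finset.mul_expect]
    linarith
  refine (ncard_div_le_of_prod (φ := φ) (a := (1 / 2) ^ (e * b)) ?_ (by positivity) hmean
    ?_).trans ?_
  · intro ω
    simp only [hφ]
    split_ifs <;> norm_num
  · intro c hc
    have hprod : ∏ i, φ (c i) = (1 / 2) ^ #{i : Fin t | Disjoint T (enlarge e (X (c i))) ∧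
        ¬ Disjoint U (enlarge e (X (c i)))} := by
      rw [← Finset.prod_const, Finset.prod_filter]
      refine Finset.prod_congr rfl fun i _ => ?_
      simp only [hφ]
      split_ifs <;> norm_num
    rw [hprod]
    refine pow_le_pow_of_le_one (by norm_num) (by norm_num) ?_
    have hsub : ({i : Fin t | Disjoint T (enlarge e (X (c i))) ∧
        ¬ Disjoint U (enlarge e (X (c i)))} : Finset (Fin t)) ⊆
        U.biUnion fun a => isolatingRows (ofRows fun i => enlarge e (X (c i))) T a := by
      intro i hi
      simp only [Finset.mem_filter, Finset.mem_univ, true_and] at hi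
      obtain ⟨a, haU, ha⟩ := Finset.not_disjoint_iff.1 hi.2
      exact Finset.mem_biUnion.2 ⟨a, haU, (mem_isolatingRows_ofRows _ _ _ _).2 ⟨ha, hi.1⟩⟩
    refine (Finset.card_le_card hsub).trans ((Finset.card_biUnion_le_card_mul _ _ b
      fun a ha => (hc a ha).le).trans ?_)
    rw [hU]
  · have h1 : (1 - 1 / 80 : ℝ) ^ t ≤ Real.exp (-t / 80) := by
      have h2 := Real.add_one_le_exp (-1 / 80 : ℝ)
      calc (1 - 1 / 80 : ℝ) ^ t ≤ Real.exp (-1 / 80) ^ t :=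
            pow_le_pow_left₀ (by norm_num) (by linarith) t
        _ = Real.exp (-t / 80) := by
            rw [← Real.exp_nat_mul]
            congr 1
            ring
    have h2 : (2 : ℝ) ^ (e * b) ≤ Real.exp (7 / 1000 * t) := by
      calc (2 : ℝ) ^ (e * b) = Real.exp ((e * b : ℕ) * Real.log 2) := by
            rw [Real.exp_nat_mul, Real.exp_log (by norm_num)]
        _ ≤ _ := by
            rw [Real.exp_le_exp]
            have h3 : (100 : ℝ) * (e * b : ℕ) ≤ t := by exact_mod_cast hb
            have h4 := Real.log_two_lt_d9
            nlinarith [Nat.cast_nonneg (α := ℝ) (e * b)]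
    calc (1 - 1 / 80 : ℝ) ^ t / (1 / 2) ^ (e * b) = (1 - 1 / 80 : ℝ) ^ t * 2 ^ (e * b) := by
          rw [one_div_pow, div_div_eq_mul_div, div_one]
      _ ≤ Real.exp (-t / 80) * Real.exp (7 / 1000 * t) := by gcongr
      _ ≤ _ := by
          rw [← Real.exp_add, Real.exp_le_exp]
          have := Nat.cast_nonneg (α := ℝ) t
          linarith

/-- The product over the rows of the weights from `KWise.bad_expect_le` is two to the total number
of bad incidences with `T`. Its mean is at most `exp(t/24000)`, whereas many overloaded columns
force it above `exp(0.69 t/12000)`. -/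
theorem ncard_many_bad_le (h : KWise k p X) (he : 1 ≤ e) (hL : 1 ≤ L)
    (hp₁ : 3 / 5 ≤ p * e) (hp₂ : p * e ≤ 61 / 100)
    (hk : e + 2 * ⌈40 * Real.log (L + 1)⌉₊ ≤ k) {T : Finset (Fin n)} (hT : T.card ≤ e)
    {𝒱 : Finset (Finset (Fin n))} (h𝒱 : 𝒱.card ≤ L)
    (hV : ∀ V ∈ 𝒱, V.card + e + ⌈40 * Real.log (L + 1)⌉₊ * e ≤ n) {b : ℕ}
    (hb : t ≤ 200 * (e * (b + 1))) :
    (Set.ncard {c : Fin t → Ω | (1 / 60 : ℝ) * e < #{a ∈ T |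
      b < (badRows (ofRows fun i => enlarge e (X (c i))) 𝒱 a).card}} : ℝ) /
        (Fintype.card Ω : ℝ) ^ t ≤ Real.exp (-t / 100000) := by
  classical
  set φ : Ω → ℝ := fun ω => if ∃ V ∈ 𝒱, enlarge e (X ω) ⊆ V
    then (2 : ℝ) ^ (T ∩ enlarge e (X ω)).card else 1 with hφ
  refine (ncard_div_le_of_prod (φ := φ) (a := Real.exp (69 / 100 * (t / 12000))) ?_
    (by positivity) (h.bad_expect_le he hL hp₁ hp₂ hk hT h𝒱 hV) ?_).trans ?_
  · intro ω
    simp only [hφ]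
    split_ifs <;> positivity
  · intro c hc
    simp only [Set.mem_ofPred_eq] at hc
    have hprod : ∏ i, φ (c i) =
        2 ^ ∑ a ∈ T, (badRows (ofRows fun i => enlarge e (X (c i))) 𝒱 a).card := by
      have h1 : ∀ a, (badRows (ofRows fun i => enlarge e (X (c i))) 𝒱 a).card =
          ∑ i, if a ∈ enlarge e (X (c i)) ∧ ∃ V ∈ 𝒱, enlarge e (X (c i)) ⊆ V then 1 else 0 := by
        intro a
        rw [← Finset.card_filter]
        congr 1
        ext i
        rw [mem_badRows_ofRows]
        simp
      simp_rw [h1]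
      rw [Finset.sum_comm, ← Finset.prod_pow_eq_pow_sum]
      refine Finset.prod_congr rfl fun i _ => ?_
      simp only [hφ]
      split_ifs with hc'
      · congr 1
        rw [← Finset.card_filter]
        congr 1
        ext a
        simp [hc']
      · simp [hc']
    rw [hprod]
    set D : Finset (Fin n) := {a ∈ T |
      b < (badRows (ofRows fun i => enlarge e (X (c i))) 𝒱 a).card} with hD
    have hle : D.card * (b + 1) ≤
        ∑ a ∈ T, (badRows (ofRows fun i => enlarge e (X (c i))) 𝒱 a).card := by
      rw [← smul_eq_mul]
      refine (Finset.card_nsmul_le_sum D _ _ fun a ha => (Finset.mem_filter.1 ha).2).trans ?_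
      exact Finset.sum_le_sum_of_subset (Finset.filter_subset _ _)
    -- More than `e/60` columns with at least `b + 1` incidences each, and `e * (b + 1) ≥ t/200`.
    have hW : (t : ℝ) / 12000 ≤ (D.card * (b + 1) : ℕ) := by
      have h1 : (t : ℝ) ≤ 200 * (e * (b + 1)) := by exact_mod_cast hb
      push_cast
      have h2 : (0 : ℝ) ≤ b := Nat.cast_nonneg b
      nlinarith
    calc Real.exp (69 / 100 * (t / 12000)) ≤ Real.exp ((D.card * (b + 1) : ℕ) * Real.log 2) := by
          rw [Real.exp_le_exp]
          have h4 := Real.log_two_gt_d9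
          have h5 : (0 : ℝ) ≤ t / 12000 := by positivity
          nlinarith
      _ = 2 ^ (D.card * (b + 1)) := by rw [Real.exp_nat_mul, Real.exp_log (by norm_num)]
      _ ≤ _ := pow_le_pow_right₀ (by norm_num) hle
  · have h1 : (1 + 1 / 24000 : ℝ) ^ t ≤ Real.exp (t / 24000) := by
      have h2 := Real.add_one_le_exp (1 / 24000 : ℝ)
      calc (1 + 1 / 24000 : ℝ) ^ t ≤ Real.exp (1 / 24000) ^ t :=
            pow_le_pow_left₀ (by norm_num) (by linarith) t
        _ = Real.exp (t / 24000) := by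
            rw [← Real.exp_nat_mul]
            congr 1
            ring
    rw [div_le_iff₀ (Real.exp_pos _)]
    refine h1.trans ?_
    rw [← Real.exp_add, Real.exp_le_exp]
    have := Nat.cast_nonneg (α := ℝ) t
    linarith

theorem ncard_setOf_exists_le {α β : Type} [Finite β] (s : Finset α) (P : α → β → Prop) {ε : ℝ}
    (h : ∀ a ∈ s, (Set.ncard {c | P a c} : ℝ) ≤ ε) :
    (Set.ncard {c | ∃ a ∈ s, P a c} : ℝ) ≤ s.card * ε := by
  have h1 : {c | ∃ a ∈ s, P a c} = ⋃ a ∈ s, {c | P a c} := by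
    ext c
    simp
  rw [h1]
  calc (Set.ncard (⋃ a ∈ s, {c | P a c}) : ℝ) ≤ (∑ a ∈ s, Set.ncard {c | P a c} : ℕ) := by
        exact_mod_cast Finset.set_ncard_biUnion_le s fun a => {c | P a c}
    _ ≤ s.card * ε := by
        push_cast
        rw [← nsmul_eq_mul]
        exact Finset.sum_le_card_nsmul _ _ _ h

theorem ncard_not_isListDisjunct_le (h : KWise k p X) (he : 1 ≤ e) (hL : 1 ≤ L)
    (hp₁ : 3 / 5 ≤ p * e) (hp₂ : p * e ≤ 61 / 100) (hn : 100000 * e ≤ n)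
    (hk : e + 2 * ⌈40 * Real.log (L + 1)⌉₊ ≤ k) (hk2 : 2 ≤ k)
    {F : Finset (Fin n) → Finset (Finset (Fin n))}
    (hF : ∀ T : Finset (Fin n), T.card ≤ e → (F T).card ≤ L ∧
      ∀ V ∈ F T, V.card + e + ⌈40 * Real.log (L + 1)⌉₊ * e ≤ n) (ht : 100 * e ≤ t) :
    (Set.ncard {c : Fin t → Ω |
      ¬ IsListDisjunct e e (1 / 60) F (ofRows fun i => enlarge e (X (c i)))} : ℝ) /
        (Fintype.card Ω : ℝ) ^ t ≤
      2 * (#{T : Finset (Fin n) | T.card ≤ e} : ℝ) ^ 2 * Real.exp (-t / 100000) := by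
  classical
  set N : Finset (Finset (Fin n)) := {T | T.card ≤ e} with hN
  have hmem : ∀ T, T ∈ N ↔ T.card ≤ e := by simp [hN]
  -- The thresholds are `b₂ = b` and `b₁ = b - 1`. Since `b ≥ 1`, rounding down loses at most a
  -- factor two, hence the `200` in `hb3`.
  set b := t / (100 * e) with hb
  have hb1 : 1 ≤ b := (Nat.one_le_div_iff (by omega)).2 ht
  have hb2 : 100 * (e * b) ≤ t := by
    rw [← mul_assoc]
    exact Nat.mul_div_le _ _
  have hb3 : t ≤ 200 * (e * (b - 1 + 1)) := by
    have h1 := Nat.lt_mul_div_succ t (show 0 < 100 * e by omega)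
    have h2 : 100 * e * (t / (100 * e) + 1) ≤ 200 * (e * b) := by
      rw [← hb]
      have : e ≤ e * b := Nat.le_mul_of_pos_right _ hb1
      calc 100 * e * (b + 1) = 100 * (e * b) + 100 * e := by ring
        _ ≤ _ := by omega
    rw [Nat.sub_add_cancel hb1]
    omega
  have hcard : (0 : ℝ) < (Fintype.card Ω : ℝ) ^ t := by
    have : (0 : ℝ) < Fintype.card Ω := by exact_mod_cast Fintype.card_pos
    positivity
  set ε := Real.exp (-t / 100000) * (Fintype.card Ω : ℝ) ^ t with hε
  have hε0 : 0 ≤ ε := by positivity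
  set M : (Fin t → Ω) → Matrix (Fin t) (Fin n) Bool :=
    fun c => ofRows fun i => enlarge e (X (c i)) with hM
  have hsub : {c : Fin t → Ω | ¬ IsListDisjunct e e (1 / 60) F (M c)} ⊆
      {c | ∃ T ∈ N, ∃ U ∈ N, (U.card = e ∧ Disjoint U T) ∧
        ∀ a ∈ U, (isolatingRows (M c) T a).card < b} ∪
      {c | ∃ T ∈ N, (1 / 60 : ℝ) * e < #{a ∈ T | b - 1 < (badRows (M c) (F T) a).card}} := by
    intro c hc
    by_contra hnot
    simp only [Set.mem_union, Set.mem_ofPred_eq, not_or, not_exists, not_and, not_lt] at hnot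
    obtain ⟨h1, h2⟩ := hnot
    refine hc ⟨b - 1, b, by omega, fun T hT => ⟨fun U hU hUT => ?_, ?_⟩⟩
    · obtain ⟨U', hU', hcU⟩ := Finset.exists_subset_card_eq hU
      have := h1 T ((hmem T).2 hT) U' ((hmem U').2 hcU.le)
        ⟨hcU, Finset.disjoint_of_subset_left hU' hUT⟩
      push Not at this
      obtain ⟨a, ha, ha'⟩ := this
      exact ⟨a, hU' ha, ha'⟩
    · exact h2 T ((hmem T).2 hT)
  have hA : (Set.ncard {c | ∃ T ∈ N, ∃ U ∈ N, (U.card = e ∧ Disjoint U T) ∧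
      ∀ a ∈ U, (isolatingRows (M c) T a).card < b} : ℝ) ≤ N.card * (N.card * ε) := by
    refine ncard_setOf_exists_le N _ fun T hT => ncard_setOf_exists_le N _ fun U hU => ?_
    by_cases hc : U.card = e ∧ Disjoint U T
    · have := ncard_few_isolating_le (t := t) h hk2 he hp₁ hp₂ hn ((hmem T).1 hT) hc.1 hc.2 hb2
      rw [div_le_iff₀ hcard] at this
      simpa [hc] using this
    · simpa [hc] using hε0
  have hB : (Set.ncard {c | ∃ T ∈ N,
      (1 / 60 : ℝ) * e < #{a ∈ T | b - 1 < (badRows (M c) (F T) a).card}} : ℝ) ≤ N.card * ε := by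
    refine ncard_setOf_exists_le N _ fun T hT => ?_
    obtain ⟨hF1, hF2⟩ := hF T ((hmem T).1 hT)
    have := ncard_many_bad_le (t := t) h he hL hp₁ hp₂ hk ((hmem T).1 hT) hF1 hF2 hb3
    rwa [div_le_iff₀ hcard] at this
  have hN1 : (1 : ℝ) ≤ N.card := by
    have : 0 < N.card := Finset.card_pos.2 ⟨∅, by simp [hN]⟩
    exact_mod_cast this
  rw [div_le_iff₀ hcard, mul_assoc, ← hε]
  have hU := Set.ncard_union_le {c | ∃ T ∈ N, ∃ U ∈ N, (U.card = e ∧ Disjoint U T) ∧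
        ∀ a ∈ U, (isolatingRows (M c) T a).card < b}
      {c | ∃ T ∈ N, (1 / 60 : ℝ) * e < #{a ∈ T | b - 1 < (badRows (M c) (F T) a).card}}
  have hU' : ((Set.ncard {c : Fin t → Ω | ¬ IsListDisjunct e e (1 / 60) F (M c)} : ℕ) : ℝ) ≤
      N.card * (N.card * ε) + N.card * ε := by
    refine le_trans ?_ (add_le_add hA hB)
    exact_mod_cast (Set.ncard_le_ncard hsub (Set.toFinite _)).trans hU
  refine hU'.trans ?_
  have : N.card * ε ≤ N.card * (N.card * ε) := by
    nlinarith [mul_nonneg (Nat.cast_nonneg (α := ℝ) N.card) hε0]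
  calc _ ≤ 2 * (N.card * (N.card * ε)) := by linarith
    _ = _ := by ring

theorem card_small_sets_le (he : 1 ≤ e) (hen : e < n) :
    #{T : Finset (Fin n) | T.card ≤ e} ≤ n ^ (2 * e) := by
  have h1 : ({T : Finset (Fin n) | T.card ≤ e} : Finset (Finset (Fin n))) ⊆
      (range (e + 1)).biUnion fun r => (univ : Finset (Fin n)).powersetCard r := by
    intro T hT
    simp only [Finset.mem_filter, Finset.mem_univ, true_and] at hT
    exact Finset.mem_biUnion.2 ⟨T.card, Finset.mem_range.2 (by omega),
      Finset.mem_powersetCard.2 ⟨Finset.subset_univ _, rfl⟩⟩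
  refine (Finset.card_le_card h1).trans
    ((Finset.card_biUnion_le_card_mul _ _ (n ^ e) fun r hr => ?_).trans ?_)
  · rw [Finset.card_powersetCard, Finset.card_univ, Fintype.card_fin]
    exact (Nat.choose_le_pow n r).trans
      (Nat.pow_le_pow_right (by omega) (by have := Finset.mem_range.1 hr; omega))
  · rw [Finset.card_range, two_mul, pow_add]
    refine Nat.mul_le_mul_right _ (le_trans hen (Nat.le_self_pow (by omega) n))

end RandomMatrix

/-! ### The construction -/

section Construction

/-- The factor `3/2` bounds `1/log 2`, and the additional digit is absorbed by `log n ≥ 1`. -/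
theorem size_le_of_le_pow {N n r : ℕ} (hn : 1 ≤ Real.log n) (h : N ≤ n ^ r) :
    (N.size : ℝ) ≤ (3 / 2 * r + 1) * Real.log n := by
  have hn0 : n ≠ 0 := fun h0 => by
    rw [h0] at hn
    norm_num at hn
  rcases Nat.eq_zero_or_pos N.size with h0 | h0
  · rw [h0, Nat.cast_zero]
    positivity
  · obtain ⟨s, hs⟩ : ∃ s, N.size = s + 1 := ⟨_, (Nat.sub_add_cancel h0).symm⟩
    have h1 : 2 ^ s ≤ n ^ r := (Nat.lt_size.1 (by omega)).trans h
    have h2 : (2 : ℝ) ^ s ≤ (n : ℝ) ^ r := by exact_mod_cast h1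
    have h3 := Real.log_le_log (by positivity) h2
    rw [Real.log_pow, Real.log_pow] at h3
    have h4 := Real.log_two_gt_d9
    have h5 : (0 : ℝ) ≤ s := Nat.cast_nonneg s
    have h6 : (0 : ℝ) ≤ r * Real.log n := by positivity
    rw [hs]
    push_cast
    nlinarith

theorem one_sub_le_bitProb {R : ℕ} {p p' : (Fin R → Bool) → Prop} {ε : ℝ}
    (h : ∀ x, ¬ p x → p' x) (hε : bitProb p' ≤ ε) : 1 - ε ≤ bitProb p := by
  classical
  have h1 : (2 : ℝ) ^ R ≤ Set.ncard {x | p x} + Set.ncard {x | p' x} := by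
    have h2 : (Set.univ : Set (Fin R → Bool)) ⊆ {x | p x} ∪ {x | p' x} := by
      intro x _
      by_cases hx : p x
      · exact Or.inl hx
      · exact Or.inr (h x hx)
    have h3 := (Set.ncard_le_ncard h2 (Set.toFinite _)).trans (Set.ncard_union_le _ _)
    rw [Set.ncard_univ, Nat.card_eq_fintype_card, Fintype.card_fun, Fintype.card_bool,
      Fintype.card_fin] at h3
    exact_mod_cast h3
  have h4 : (1 : ℝ) ≤ bitProb p + bitProb p' := by
    rw [bitProb, bitProb, ← add_div, le_div_iff₀ (by positivity), one_mul]
    exact h1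
  linarith

theorem exists_of_bitProb_pos {R : ℕ} {p : (Fin R → Bool) → Prop} (h : 0 < bitProb p) :
    ∃ x, p x := by
  by_contra hne
  push Not at hne
  have : {x | p x} = ∅ := by
    ext x
    simpa using hne x
  rw [bitProb, this] at h
  simp at h

/-- The matrix computed by the program from the random bits `x`. -/
noncomputable def hashMatrix (n e t : ℕ) {R : ℕ} (x : Fin R → Bool) :
    Matrix (Fin t) (Fin n) Bool := fun i j => hashEntry x n e t i j

theorem hashMatrix_eq {n e t R : ℕ} [Fact (primeAbove n).Prime] (x : Fin R → Bool) :
    hashMatrix n e t x = ofRows fun i => enlarge e (polyRow n e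
      (coefs (primeAbove n) t (R / (t * (1000 * n * R).size)) (1000 * n * R).size x i)) := by
  funext i j
  rw [ofRows, hashMatrix, hashEntry]
  simp only [mem_enlarge_iff]
  rw [Bool.decide_or]

theorem rowWeightsAtLeast_hashMatrix {n e t R : ℕ} (he : 1 ≤ e) (x : Fin R → Bool) :
    RowWeightsAtLeast (hashMatrix n e t x) ((n : ℝ) / (2 * (e : ℝ))) := by
  have : Fact (primeAbove n).Prime := ⟨prime_primeAbove n⟩
  intro i
  rw [hashMatrix_eq, rowSet_ofRows, div_le_iff₀ (by positivity), mul_comm]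
  exact_mod_cast le_card_enlarge e _ he

/-- The union bound costs at most `exp(4 e log n)` against `exp(-t/100000) ≤ exp(-100 e log n)`.
This leaves room for the constant factor `4` and the gain `1/n`. -/
theorem hashMatrix_bitProb {n e t R L l : ℕ} (hl : l = ⌈40 * Real.log ((L : ℝ) + 1)⌉₊) (he : 1 ≤ e) (hL : 1 ≤ L) (hn : 100000 * e ≤ n)
    (hn2 : 4 ≤ n) (ht : (10000000 : ℝ) * e * Real.log n ≤ t) (hte : 100 * e ≤ t)
    (hR : (e + 2 * l) * (t * (1000 * n * R).size) ≤ R) (hR0 : 0 < R)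
    {F : Finset (Fin n) → Finset (Finset (Fin n))}
    (hF : ∀ T : Finset (Fin n), T.card ≤ e → (F T).card ≤ L ∧
      ∀ V ∈ F T, V.card + e + l * e ≤ n) :
    1 - (n : ℝ) ^ (-(1 : ℝ)) ≤ bitProb fun x : Fin R → Bool =>
      IsListDisjunct e e (1 / 60) F (hashMatrix n e t x) ∧
        RowWeightsAtLeast (hashMatrix n e t x) ((n : ℝ) / (2 * (e : ℝ))) := by
  have : Fact (primeAbove n).Prime := ⟨prime_primeAbove n⟩
  set q := primeAbove n with hq
  set m := (1000 * n * R).size with hm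
  set k := R / (t * m) with hk
  have hqn : n ≤ q := le_primeAbove n
  have hqn2 : q ≤ 2 * n := primeAbove_le_two_mul (by omega)
  have hl1 : 1 ≤ l := by
    rw [hl, Nat.one_le_ceil_iff]
    have : (1 : ℝ) ≤ L := by exact_mod_cast hL
    have : 0 < Real.log ((L : ℝ) + 1) := Real.log_pos (by linarith)
    positivity
  have hm1 : 1 ≤ m := Nat.size_pos.2 (by positivity)
  have htm : 0 < t * m := Nat.mul_pos (by omega) hm1
  have hkl : e + 2 * l ≤ k := (Nat.le_div_iff_mul_le htm).2 hR
  have hkm : t * k * m ≤ R := by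
    calc t * k * m = R / (t * m) * (t * m) := by rw [hk]; ring
      _ ≤ R := Nat.div_mul_le_self _ _
  -- The block length is computed from `n` and `R` alone: `q ≤ 2n` and `t * k ≤ R` give `2qtk ≤
  -- 4nR`.
  have hqk : 2 * q * (t * k) ≤ 2 ^ m := by
    have h1 : t * k ≤ R := (Nat.le_mul_of_pos_right _ hm1).trans hkm
    have h2 : 2 * q * (t * k) ≤ 2 * (2 * n) * R := Nat.mul_le_mul (by omega) h1
    have h3 : 1000 * n * R < 2 ^ m := Nat.lt_size_self _
    have h4 : 2 * (2 * n) * R ≤ 1000 * n * R := Nat.mul_le_mul_right _ (by omega)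
    omega
  have hkw := kWise_polyRow (q := q) (k := k) (n := n) (e := e) (by omega) hqn he
  have hprob := ncard_not_isListDisjunct_le (t := t) hkw he hL
    (le_density_mul (by omega) he) (density_mul_le (by omega) he) hn (hl ▸ hkl) (by omega)
    (hl ▸ hF) hte
  refine one_sub_le_bitProb (p' := fun x => coefs q t k m x ∈ {c : Fin t → Fin k → ZMod q |
    ¬ IsListDisjunct e e (1 / 60) F (ofRows fun i => enlarge e (polyRow n e (c i)))}) ?_ ?_
  · intro x hx hx'
    refine hx ⟨?_, rowWeightsAtLeast_hashMatrix he x⟩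
    rw [hashMatrix_eq]
    exact hx'
  · refine (bitProb_coefs_le hkm hqk _).trans ?_
    refine (mul_le_mul_of_nonneg_left hprob (by norm_num)).trans ?_
    have hn0 : (0 : ℝ) < n := by
      have : 0 < n := by omega
      exact_mod_cast this
    have he' : (1 : ℝ) ≤ e := by exact_mod_cast he
    have hcard : ((Finset.univ.filter fun T : Finset (Fin n) => T.card ≤ e).card : ℝ) ≤
        Real.exp (2 * e * Real.log n) := by
      have h1 := card_small_sets_le (n := n) he (by omega)
      have h2 : ((Finset.univ.filter fun T : Finset (Fin n) => T.card ≤ e).card : ℝ) ≤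
          (n : ℝ) ^ (2 * e) := by exact_mod_cast h1
      refine h2.trans (le_of_eq ?_)
      rw [← Real.exp_log hn0, ← Real.exp_nat_mul, Real.log_exp]
      push_cast
      ring_nf
    have hlog : Real.log 4 ≤ Real.log n :=
      Real.log_le_log (by norm_num) (by exact_mod_cast hn2)
    have hlog0 : 0 ≤ Real.log n := le_trans (Real.log_nonneg (by norm_num)) hlog
    have hel : Real.log n ≤ e * Real.log n := le_mul_of_one_le_left hlog0 he'
    calc 2 * (2 * ((Finset.univ.filter fun T : Finset (Fin n) => T.card ≤ e).card : ℝ) ^ 2 *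
          Real.exp (-t / 100000))
        ≤ 2 * (2 * Real.exp (2 * e * Real.log n) ^ 2 * Real.exp (-t / 100000)) := by gcongr
      _ = Real.exp (Real.log 4 + 2 * (2 * e * Real.log n) + -t / 100000) := by
          rw [Real.exp_add, Real.exp_add, Real.exp_log (by norm_num),
            show (2 : ℝ) * (2 * e * Real.log n) = (2 : ℕ) * (2 * e * Real.log n) by norm_num,
            Real.exp_nat_mul]
          ring
      _ ≤ Real.exp (-Real.log n) := by
          rw [Real.exp_le_exp]
          linarith
      _ = _ := by
          rw [Real.rpow_neg_one, Real.exp_neg, Real.exp_log hn0]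

end Construction

/-! ### Choice of constants and assembly -/

theorem mainTheorem7 :
    ∃ κ : ℝ, 0 < κ ∧ ∃ c₀ : ℝ, 1 < c₀ ∧ ∀ c : ℝ, c₀ ≤ c →
      ∃ (C δ A : ℝ) (B k : ℕ) (P : Prog (Fin (k + 1))), 0 < C ∧ 0 < δ ∧
        ∀ n e d a L : ℕ, 2 ≤ n → 1 ≤ e → 1 ≤ d → 1 ≤ a → 1 ≤ L →
          (a : ℝ) ≤ (n : ℝ) - (d : ℝ) / 2 →
          (e : ℝ) ≤ κ * ((d : ℝ) / Real.log ((L : ℝ) + 1)) →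
          c * e * Real.log n ≤ n →
          (∀ F : Finset (Fin n) → Finset (Finset (Fin n)),
            IsForbiddenFamily F e L a ((n : ℝ) - (d : ℝ) / 2) →
            ∃ M : Matrix (Fin (numRows c n e)) (Fin n) Bool,
              IsListDisjunct e e (1 / 60) F M ∧
              RowWeightsAtLeast M ((n : ℝ) / (2 * (e : ℝ)))) ∧
          ∃ G : (Fin (numRandomBits C n e L (numRows c n e)) → Bool) →
              Matrix (Fin (numRows c n e)) (Fin n) Bool,
            (∀ F : Finset (Fin n) → Finset (Finset (Fin n)),
              IsForbiddenFamily F e L a ((n : ℝ) - (d : ℝ) / 2) →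
              1 - (n : ℝ) ^ (-δ) ≤
                bitProb fun x => IsListDisjunct e e (1 / 60) F (G x) ∧
                  RowWeightsAtLeast (G x) ((n : ℝ) / (2 * (e : ℝ)))) ∧
            ∀ x i j,
              ComputesBitInSpace P
                [n, e, numRows c n e, numRandomBits C n e L (numRows c n e), i.val, j.val]
                x (A * Real.log n ^ B) (G x i j) := by
  refine ⟨1 / 100, by norm_num, 10000000, by norm_num, fun c hc => ?_⟩
  -- `C = 100000` exceeds `80 · 13 / log 2`, needed for `e + 2l` coefficients of at most `13 log n`
  -- bits in each row. The space constant `360` covers `24 · (3/2 · 9 + 1) = 348`.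
  refine ⟨100000, 1, 360, 1, 23, entryProgram, by norm_num, by norm_num, ?_⟩
  intro n e d a L hn he hd ha hL had hed hcn
  have hn' : (2 : ℝ) ≤ n := by exact_mod_cast hn
  have he' : (1 : ℝ) ≤ e := by exact_mod_cast he
  have ha' : (1 : ℝ) ≤ a := by exact_mod_cast ha
  have hL' : (1 : ℝ) ≤ L := by exact_mod_cast hL
  have hlog2 := Real.log_two_gt_d9
  have hlog2' := Real.log_two_lt_d9
  have hce : 10000000 * (e : ℝ) ≤ c * e := by gcongr
  have hlogn0 : Real.log 2 ≤ Real.log n := Real.log_le_log (by norm_num) hn'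
  have hcel : 10000000 * (e : ℝ) * Real.log n ≤ c * e * Real.log n := by gcongr
  -- The hypothesis `c * e * log n ≤ n` with `c ≥ 10^7` forces `n` to be large, which lets powers of
  -- `n` absorb constants.
  have hbig : (1000000 : ℝ) ≤ n := by
    have : (10000000 : ℝ) * 1 * Real.log 2 ≤ 10000000 * e * Real.log n := by gcongr
    linarith
  have hlogn : 1 ≤ Real.log n := by
    rw [Real.le_log_iff_exp_le (by linarith)]
    have := Real.exp_one_lt_d9
    linarith
  have hlognn : Real.log n ≤ n := (Real.log_le_sub_one_of_pos (by linarith)).trans (by linarith)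
  have hel : 10000000 * (e : ℝ) ≤ 10000000 * e * Real.log n :=
    le_mul_of_one_le_right (by positivity) hlogn
  have hne : 10000000 * (e : ℝ) ≤ n := by linarith
  set lam := Real.log ((L : ℝ) + 1) with hlam
  have hlam2 : Real.log 2 ≤ lam := Real.log_le_log (by norm_num) (by linarith)
  have hlam0 : 0 < lam := by linarith
  have hed' : 100 * (e * lam) ≤ d := by
    rw [← mul_div_assoc, le_div_iff₀ hlam0] at hed
    linarith
  have helam : (e : ℝ) ≤ 2 * (e * lam) := by
    have : (e : ℝ) * (1 / 2) ≤ e * lam := by gcongr; linarith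
    linarith
  have helam' : lam ≤ e * lam := le_mul_of_one_le_left hlam0.le he'
  -- From `1 ≤ a ≤ n - d/2`. With `100 e log(L+1) ≤ d` this bounds `log L` in terms of `n`, and so
  -- makes `R` polynomial in `n`.
  have hdn : (d : ℝ) ≤ 2 * n := by linarith
  have hlogL0 : 0 ≤ Real.log L := Real.log_nonneg hL'
  have hlogL : Real.log L ≤ lam := Real.log_le_log (by linarith) (by linarith)
  have hlamL : lam ≤ Real.log L + Real.log 2 := by
    rw [← Real.log_mul (by linarith) (by norm_num)]
    exact Real.log_le_log (by linarith) (by linarith)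
  set l := ⌈40 * lam⌉₊ with hl
  have hl' : (l : ℝ) ≤ 40 * lam + 1 := (Nat.ceil_lt_add_one (by positivity)).le
  set t := numRows c n e with ht
  have ht₁ : c * e * Real.log n ≤ t := Nat.le_ceil _
  have ht₂ : t ≤ n := Nat.ceil_le.2 hcn
  have ht₂' : (t : ℝ) ≤ n := by exact_mod_cast ht₂
  have hte' : 100 * (e : ℝ) ≤ t := by linarith
  set R := numRandomBits 100000 n e L t with hR
  set ρ := 100000 * (t : ℝ) * (e + Real.log L) * Real.log ((e : ℝ) + 1) * Real.log n with hρ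
  have hloge : Real.log 2 ≤ Real.log ((e : ℝ) + 1) :=
    Real.log_le_log (by norm_num) (by linarith)
  have hloge' : Real.log ((e : ℝ) + 1) ≤ e := by
    have := Real.log_le_sub_one_of_pos (show (0 : ℝ) < e + 1 by linarith)
    linarith
  have hloge0 : 0 ≤ Real.log ((e : ℝ) + 1) := by linarith
  have hρ0 : 0 ≤ ρ := by positivity
  have hR₁ : ρ ≤ R := Nat.le_ceil _
  have hR₂ : (R : ℝ) ≤ ρ + 1 := (Nat.ceil_lt_add_one hρ0).le
  clear_value t R
  have hρn : ρ ≤ (n : ℝ) ^ 5 := by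
    have h1 : e + Real.log L ≤ n := by linarith
    have h2 : Real.log ((e : ℝ) + 1) ≤ n := by linarith
    calc ρ ≤ n * n * n * n * n := by
          rw [hρ]
          gcongr
          linarith
      _ = (n : ℝ) ^ 5 := by ring
  have hRn : R ≤ n ^ 5 + 1 := by
    have : (R : ℝ) ≤ (n : ℝ) ^ 5 + 1 := by linarith
    exact_mod_cast this
  have hbig' : 1000000 ≤ n := by exact_mod_cast hbig
  have hRn' : R + 1 ≤ n ^ 6 := by
    have h1 : 1 ≤ n ^ 5 := Nat.one_le_pow _ _ (by omega)
    calc R + 1 ≤ 3 * n ^ 5 := by omega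
      _ ≤ n * n ^ 5 := Nat.mul_le_mul_right _ (by omega)
      _ = n ^ 6 := by ring
  have hm : ((1000 * n * R).size : ℝ) ≤ 13 * Real.log n := by
    have h1 : 1000 * n * R ≤ n ^ 8 := by
      calc 1000 * n * R ≤ n * n * n ^ 6 := by
            refine Nat.mul_le_mul (Nat.mul_le_mul_right _ (by omega)) (by omega)
        _ = n ^ 8 := by ring
    refine (size_le_of_le_pow hlogn h1).trans (le_of_eq ?_)
    norm_num
  have hspace : ((24 * Nat.size (10000 * n ^ 2 * (R + 1)) : ℕ) : ℝ) ≤ 360 * Real.log n ^ 1 := by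
    have h1 : 10000 * n ^ 2 * (R + 1) ≤ n ^ 9 := by
      calc 10000 * n ^ 2 * (R + 1) ≤ n * n ^ 2 * n ^ 6 :=
            Nat.mul_le_mul (Nat.mul_le_mul_right _ (by omega)) hRn'
        _ = n ^ 9 := by ring
    have h2 := size_le_of_le_pow hlogn h1
    push_cast at h2 ⊢
    linarith
  have hkR : (e + 2 * l) * (t * (1000 * n * R).size) ≤ R := by
    have h1 : ((e + 2 * l) * (t * (1000 * n * R).size) : ℝ) ≤ ρ := by
      have h2 : (e : ℝ) + 2 * l ≤ 80 * (e + Real.log L) := by linarith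
      calc ((e + 2 * l) * (t * (1000 * n * R).size) : ℝ)
          ≤ 80 * (e + Real.log L) * (t * (13 * Real.log n)) := by gcongr
        _ = 1040 * (t * (e + Real.log L) * Real.log n) := by ring
        _ ≤ 100000 * Real.log ((e : ℝ) + 1) * (t * (e + Real.log L) * Real.log n) := by
            gcongr
            linarith
        _ = ρ := by rw [hρ]; ring
    have h3 := h1.trans hR₁
    exact_mod_cast h3
  have hR0 : 0 < R := by
    have : 0 < ρ := by
      have h1 : 0 < (t : ℝ) := by linarith
      have h2 : 0 < Real.log ((e : ℝ) + 1) := by linarith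
      positivity
    exact_mod_cast this.trans_le hR₁
  clear_value l ρ
  have hprob : ∀ F : Finset (Fin n) → Finset (Finset (Fin n)),
      IsForbiddenFamily F e L a ((n : ℝ) - (d : ℝ) / 2) →
      1 - (n : ℝ) ^ (-(1 : ℝ)) ≤ bitProb fun x : Fin R → Bool =>
        IsListDisjunct e e (1 / 60) F (hashMatrix n e t x) ∧
          RowWeightsAtLeast (hashMatrix n e t x) ((n : ℝ) / (2 * (e : ℝ))) := by
    intro F hF
    refine hashMatrix_bitProb (hl.trans (by rw [hlam])) he hL ?_ (by omega)
      (hcel.trans ht₁) (by exact_mod_cast hte') hkR hR0 fun T hT => ⟨(hF T hT).1, fun V hV => ?_⟩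
    · have : 100000 * (e : ℝ) ≤ n := by linarith
      exact_mod_cast this
    · have h1 := ((hF T hT).2 V hV).2
      have h2 : (l : ℝ) * e ≤ 40 * (e * lam) + e := by
        calc (l : ℝ) * e ≤ (40 * lam + 1) * e := by gcongr
          _ = _ := by ring
      -- The loss `e + l * e` is at most `44 e log(L+1)`, below the `d/2 ≥ 50 e log(L+1)` that the
      -- size bound on `V` leaves free; this is where `κ = 1/100` is used.
      have h4 : (V.card + e + l * e : ℝ) ≤ n := by linarith
      exact_mod_cast h4
  refine ⟨fun F hF => ?_, hashMatrix n e t, hprob, fun x i j => ?_⟩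
  · have hpos : (0 : ℝ) < 1 - (n : ℝ) ^ (-(1 : ℝ)) := by
      rw [Real.rpow_neg_one, sub_pos]
      exact inv_lt_one_of_one_lt₀ (by linarith)
    obtain ⟨x, hx⟩ := exists_of_bitProb_pos (hpos.trans_le (hprob F hF))
    exact ⟨_, hx⟩
  · have hen : e ≤ n := by
      have : (e : ℝ) ≤ n := by linarith
      exact_mod_cast this
    obtain ⟨s', τ, h₁, h₂⟩ := entryProgram_computes (R := R) (x := x) hn i.isLt j.isLt hen ht₂
    exact ⟨s', τ, h₁.trans hspace, h₂⟩
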